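/- Let $d=3$ or $d=4$. Then, up to isometry, there are exactly two self-similar, hyperorthogonal, well-folded $d$-dimensional space-filling curves; that is, there are two such curves $f,g$ that are not isometric to each other, and every such curve is isometric to $f$ or to $g$. The terms mean the following. A *curve* (on the grid) is a nonempty finite sequence of distinct vertices of $\mathbb{Z}^d$ in which consecutive vertices have distance $1$ (they form an *edge*, whose *axis* is the coordinate in which they differ). A *$k$-curve* is a curve whose vertex set is a cube of $2^k\times\dots\times 2^k$ grid points. Isometric images of a curve are its images under a signed permutation of the coordinates followed by a translation, possibly followed by reversing the order of the vertices. A curve $Q$ is obtained from a curve $P=(v_1,\dots,v_m)$ by *inflation* if $Q$ is the concatenation of curves $C_1,\dots,C_m$ (the child curves), where $C_i$ visits exactly the vertices of $2v_i+\{0,1\}^d$ and the first vertex of $C_{i+1}$ minus the last vertex of $C_i$ equals $v_{i+1}-v_i$. The curve $G(d)$ is the curve starting at the origin with edge directions given recursively by: $G(0)$ is empty, and $G(d)$ is $G(d-1)$, then $\langle d\rangle$, then $G(d-1)$ in reverse order with all directions negated, where direction $\pm i$ denotes a unit step $\pm$ along axis $i$. A curve on the grid is *well-folded* if it is a single vertex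 or is obtained by inflation of a well-folded curve with all child curves isometric images of $G(d)$. It is *hyperorthogonal* if for every $n\in\{0,\dots,d-2\}$ any $2^n$ consecutive edges of it have exactly $n+1$ different axes. A ($d$-dimensional) *space-filling curve* is here a continuous surjective map $f:[0,1]\to[0,1]^d$ for which there are *approximating curves* $A_0,A_1,\dots$: $A_0$ is the single vertex $0$, $A_k$ is a $k$-curve, $A_{k+1}$ is obtained from $A_k$ by inflation, and if $A_k=(v_0,\dots,v_{K-1})$, $K=2^{dk}$, then $f([i/K,(i+1)/K])=2^{-k}(v_i+[0,1]^d)$ for all $0\le i<K$. (These $A_k$ are determined by $f$.) Such an $f$ is *well-folded*, respectively *hyperorthogonal*, if every $A_k$ is, and it is *self-similar* if for every $k\ge 0$ the curve $A_{k+1}$ is the concatenation of $2^d$ isometric images of $A_k$. Two space-filling curves $f,g$ are *isometric* if there is an isometry $\varphi$ of $\mathbb{R}^d$ with $g(t)=\varphi(f(t))$ for all $t$, or $g(t)=\varphi(f(1-t))$ for all $t$. -/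

import Mathlib

namespace GridCurve

/-- A vertex of the `d`-dimensional integer grid. -/
abbrev Vertex (d : ℕ) := Fin d → ℤ

/-- `(v, w)` is an edge of the grid: the two vertices have (Euclidean) distance 1. -/
def IsEdge {d : ℕ} (v w : Vertex d) : Prop := ∑ j, (w j - v j) ^ 2 = 1

/-- A curve on the grid, given by its vertices in order: a nonempty sequence of distinct vertices
in which every two consecutive vertices form an edge. -/
def IsCurve {d : ℕ} (C : List (Vertex d)) : Prop :=
  C ≠ [] ∧ C.Nodup ∧ C.IsChain IsEdge

/-- A `k`-curve: a curve whose vertices are exactly those of some cube with `2 ^ k` grid points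
along each side. -/
def IsKCurve {d : ℕ} (k : ℕ) (C : List (Vertex d)) : Prop :=
  IsCurve C ∧ ∃ t : Vertex d, ∀ v, v ∈ C ↔ ∀ j, t j ≤ v j ∧ v j < t j + 2 ^ k

/-- The distance-preserving maps of the grid: a signed permutation of the coordinates followed by
a translation. -/
def IsGridIsometry {d : ℕ} (φ : Vertex d → Vertex d) : Prop :=
  ∃ (π : Equiv.Perm (Fin d)) (s : Fin d → ℤˣ) (t : Vertex d),
    ∀ v j, φ v j = s j * v (π j) + t j

/-- `C'` is an isometric image of the curve `C`; taking the reverse counts as an isometry. -/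
def IsIsometricImage {d : ℕ} (C C' : List (Vertex d)) : Prop :=
  ∃ φ : Vertex d → Vertex d, IsGridIsometry φ ∧ (C' = C.map φ ∨ C' = (C.map φ).reverse)

/-- The directions of the edges of the Gray code curve `G(d)`: direction `i` (resp. `-i`), with
`1 ≤ i ≤ d`, is a unit step forwards (resp. backwards) along the `i`-th axis. -/
def grayCode : ℕ → List ℤ
  | 0 => []
  | d + 1 => grayCode d ++ [(d : ℤ) + 1] ++ (grayCode d).reverse.map (fun a => -a)

/-- The unit step in direction `a`; the `i`-th axis is coordinate `i - 1` of `Fin d`. -/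
def step (d : ℕ) (a : ℤ) : Vertex d :=
  fun j => if a.natAbs = (j : ℕ) + 1 then a.sign else 0

/-- The curve `G(d)` with its entry at the origin. -/
def grayCurve (d : ℕ) : List (Vertex d) :=
  (grayCode d).scanl (fun v a => v + step d a) 0

/-- `Q` is obtained from `P` by inflation with child curves satisfying `ok`. The list `L` pairs each
vertex `v` of `P` with its child curve `C`, a curve on the unit cube translated by `2 * v`; the
edge from `v` to the next vertex `w` of `P` becomes an edge of the same direction from the exit of
the child curve of `v` to the entry of the child curve of `w`. -/
def IsInflation {d : ℕ} (ok : List (Vertex d) → Prop) (P Q : List (Vertex d)) : Prop :=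
  ∃ L : List (Vertex d × List (Vertex d)),
    L.map Prod.fst = P ∧
    L.flatMap Prod.snd = Q ∧
    (∀ p ∈ L, IsCurve p.2 ∧ (∀ w, w ∈ p.2 ↔ ∀ j, w j = 2 * p.1 j ∨ w j = 2 * p.1 j + 1) ∧
      ok p.2) ∧
    L.IsChain (fun p q => ∀ b ∈ p.2.getLast?, ∀ c ∈ q.2.head?, c - b = q.1 - p.1)

/-- Well-folded curves on the grid. -/
inductive WellFolded {d : ℕ} : List (Vertex d) → Prop
  | vertex (v : Vertex d) : WellFolded [v]
  | inflate {P Q : List (Vertex d)} :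
      WellFolded P → IsInflation (IsIsometricImage (grayCurve d)) P Q → WellFolded Q

/-- The set of axes of the edges of a curve. -/
def axes {d : ℕ} (C : List (Vertex d)) : Set (Fin d) :=
  {j | ∃ v w, [v, w] <:+: C ∧ v j ≠ w j}

/-- Hyperorthogonality: for `0 ≤ n ≤ d - 2`, any `2 ^ n` consecutive edges (that is, any subcurve
with `2 ^ n + 1` vertices) have exactly `n + 1` different axes. -/
def Hyperorthogonal {d : ℕ} (C : List (Vertex d)) : Prop :=
  ∀ n : ℕ, n + 2 ≤ d → ∀ S : List (Vertex d), S <:+: C → S.length = 2 ^ n + 1 →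
    (axes S).ncard = n + 1

/-- Self-similarity: each `A (k + 1)` is the concatenation of `2 ^ d` isometric copies
of `A k`. -/
def SelfSimilar {d : ℕ} (A : ℕ → List (Vertex d)) : Prop :=
  ∀ k, ∃ L : List (List (Vertex d)),
    L.length = 2 ^ d ∧ L.flatten = A (k + 1) ∧ ∀ C ∈ L, IsIsometricImage (A k) C

/-- The unit cube `[0,1]^d`. -/
def unitCube (d : ℕ) : Set (EuclideanSpace ℝ (Fin d)) :=
  {x | ∀ j, 0 ≤ x j ∧ x j ≤ 1}

/-- The cube of width `1 / 2 ^ k` that is represented by the vertex `v` of a `k`-curve. -/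
def cell {d : ℕ} (k : ℕ) (v : Vertex d) : Set (EuclideanSpace ℝ (Fin d)) :=
  {x | ∀ j, (v j : ℝ) / 2 ^ k ≤ x j ∧ x j ≤ ((v j : ℝ) + 1) / 2 ^ k}

/-- A space-filling curve: a continuous map from `[0,1]` onto `[0,1]^d`. -/
def IsSpaceFilling {d : ℕ} (f : unitInterval → EuclideanSpace ℝ (Fin d)) : Prop :=
  Continuous f ∧ Set.range f = unitCube d

/-- `A 0, A 1, …` are the approximating curves of `f`: `A 0` is a single vertex, `A k` is a
`k`-curve, `A (k + 1)` arises from `A k` by inflation, and `f` traverses the cubes represented by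
the `2 ^ (d * k)` vertices of `A k` in order, each one during a time interval of equal length.
The last condition determines `A` from `f`. -/
structure Approximates {d : ℕ} (A : ℕ → List (Vertex d))
    (f : unitInterval → EuclideanSpace ℝ (Fin d)) : Prop where
  zero : A 0 = [0]
  kCurve : ∀ k, IsKCurve k (A k)
  inflation : ∀ k, IsInflation (fun _ => True) (A k) (A (k + 1))
  image_eq : ∀ (k i : ℕ) (h : i < (A k).length),
    f '' {t | (i : ℝ) / 2 ^ (d * k) ≤ (t : ℝ) ∧ (t : ℝ) ≤ ((i : ℝ) + 1) / 2 ^ (d * k)} =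
      cell k (A k)[i]

/-- `f` is a self-similar, hyperorthogonal, well-folded `d`-dimensional space-filling curve: its
approximating curves have these properties. -/
def IsSelfSimilarHyperorthogonalWellFolded {d : ℕ}
    (f : unitInterval → EuclideanSpace ℝ (Fin d)) : Prop :=
  IsSpaceFilling f ∧ ∃ A : ℕ → List (Vertex d), Approximates A f ∧
    (∀ k, WellFolded (A k)) ∧ (∀ k, Hyperorthogonal (A k)) ∧ SelfSimilar A

/-- `f` and `g` are the same space-filling curve up to isometry: `g` is the image of `f` or of the
reverse of `f` under an isometry of Euclidean space (which then maps the unit cube to itself when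
both are space-filling). -/
def SameUpToIsometry {d : ℕ} (f g : unitInterval → EuclideanSpace ℝ (Fin d)) : Prop :=
  ∃ φ : EuclideanSpace ℝ (Fin d) ≃ᵢ EuclideanSpace ℝ (Fin d),
    (∀ t, g t = φ (f t)) ∨ (∀ t, g t = φ (f (unitInterval.symm t)))

end GridCurve

/-! The reverse of `G(d)` is its mirror image in the last axis. So an isometric image of `G(d)` on a
given unit cube is described by a signed permutation alone, its state, and a well-folded inflation
amounts to a choice of one state per vertex, which the inflated curve determines (`exists_block`,
`inflate_injective`). A window in the definition of hyperorthogonality is so short that it meets at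
most two consecutive child curves. Hyperorthogonality of the inflation is therefore a relation
`Link` between consecutive states `s`, `t`: the corners must match, and `s⁻¹ * t` must lie in a
fixed finite set, of 8 elements for `d = 3` and 12 for `d = 4` (`link_iff`,
`hyperorthogonal_inflate`, `exists_states`).

By self-similarity each curve consists of `2 ^ d` images of its predecessor, placed along the first
curve. Each image is given by a signed permutation and a reversal bit, so there are only finitely
many lists `D` of images. A list that builds level `k + 2` from level `k + 1` also builds level `k +
1` from level `k`, because the states can be read off from the next level. By pigeonhole one list
serves infinitely many levels, hence all (`exists_forall_eq_flatMap_place`). Up to a signed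
permutation the curves are thus those of `pattern D` (`exists_eq_placeV_curves`). All links hold at
all levels if and only if the images fit together for the pair of end states of each level (`Fits`),
and this pair evolves by a recursion on a finite set.

The conditions for the end states of levels 0 and 1 leave only four lists (`mem_solutions`,
`CurveFacts`): two lists and their conjugates under reflection with reversal, which give isometric
curves (`pattern_conj`). For the two lists the end states repeat with period 2 from level 1 on, so
checks at levels 0, 1, 2 suffice at all levels (`IsValid.isAdmissible`).

Nested cells turn approximating curves into a continuous limit (`exists_approximates`), and
isometric approximations into isometric limits (`Approximates.sameUpToIsometry`). The two limits are
not isometric: their end points have different distances, which is visible from the end vertices at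
level 4 (`dist_lt_dist_of_mem_cell`). -/

namespace GridCurve

variable {d : ℕ}

/-! ### Signed permutations and their action on cubes -/

/-- A signed permutation of `d` axes. -/
@[ext] structure SPerm (d : ℕ) where
  /-- the coordinate from which each coordinate of the image is taken -/
  perm : Equiv.Perm (Fin d)
  /-- whether a coordinate of the image is reflected -/
  neg : Fin d → Bool

namespace SPerm

/-- The permutations are composed in reverse order because coordinate `j` of the image is read from
coordinate `g.perm j`; with this product `act` is a left action. -/
instance : Mul (SPerm d) :=
  ⟨fun g h => ⟨h.perm * g.perm, fun j => xor (g.neg j) (h.neg (g.perm j))⟩⟩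

instance : One (SPerm d) := ⟨⟨1, fun _ => false⟩⟩

instance : Inv (SPerm d) := ⟨fun g => ⟨g.perm⁻¹, fun j => g.neg (g.perm⁻¹ j)⟩⟩

@[simp] theorem mul_perm (g h : SPerm d) : (g * h).perm = h.perm * g.perm := rfl
@[simp] theorem mul_neg (g h : SPerm d) (j : Fin d) :
    (g * h).neg j = xor (g.neg j) (h.neg (g.perm j)) := rfl
@[simp] theorem one_perm : (1 : SPerm d).perm = 1 := rfl
@[simp] theorem one_neg (j : Fin d) : (1 : SPerm d).neg j = false := rfl
@[simp] theorem inv_perm (g : SPerm d) : g⁻¹.perm = g.perm⁻¹ := rfl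
@[simp] theorem inv_neg (g : SPerm d) (j : Fin d) : g⁻¹.neg j = g.neg (g.perm⁻¹ j) := rfl

instance : Group (SPerm d) :=
  Group.ofLeftAxioms
    (fun a b c => by ext j <;> simp [mul_assoc])
    (fun a => by ext j <;> simp)
    (fun a => by ext j <;> simp)

/-- The reflection in the last axis. -/
def flip (d : ℕ) : SPerm d := ⟨1, fun j => decide ((j : ℕ) + 1 = d)⟩

@[simp] theorem flip_mul_flip : flip d * flip d = 1 := by
  ext j
  · simp [flip]
  · simp only [mul_neg, one_neg]
    exact Bool.xor_self _

/-- The reflection in the last axis if the argument is true. -/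
def flipIf (d : ℕ) (b : Bool) : SPerm d := if b then flip d else 1

@[simp] theorem flipIf_true : flipIf d true = flip d := rfl
@[simp] theorem flipIf_false : flipIf d false = 1 := rfl

theorem flipIf_mul (a b : Bool) : flipIf d a * flipIf d b = flipIf d (xor a b) := by
  cases a <;> cases b <;> simp

instance : Finite (SPerm d) :=
  Finite.of_injective (fun g : SPerm d => (g.perm, g.neg)) fun g h e => by
    ext1
    · exact congrArg Prod.fst e
    · exact congrArg Prod.snd e

end SPerm

/-- The action of signed permutations on the cube with corners `0` and `2 ^ k - 1`. -/
def act (k : ℕ) (g : SPerm d) (v : Vertex d) : Vertex d :=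
  fun j => if g.neg j then 2 ^ k - 1 - v (g.perm j) else v (g.perm j)

/-- The point `x` of the cube that is represented by `v`, each cube having width `2 ^ k`. -/
def shift (k : ℕ) (v x : Vertex d) : Vertex d := fun j => 2 ^ k * v j + x j

theorem act_mul (k : ℕ) (g h : SPerm d) (v : Vertex d) :
    act k (g * h) v = act k g (act k h v) := by
  funext j
  simp only [act, SPerm.mul_neg, SPerm.mul_perm, Equiv.Perm.mul_apply]
  by_cases hg : g.neg j = true <;> by_cases hh : h.neg (g.perm j) = true <;> simp [hg, hh]

@[simp] theorem act_one (k : ℕ) (v : Vertex d) : act k 1 v = v := by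
  funext j; simp [act]

@[simp] theorem act_inv_act (k : ℕ) (g : SPerm d) (v : Vertex d) :
    act k g⁻¹ (act k g v) = v := by rw [← act_mul]; simp

@[simp] theorem act_act_inv (k : ℕ) (g : SPerm d) (v : Vertex d) :
    act k g (act k g⁻¹ v) = v := by rw [← act_mul]; simp

@[simp] theorem act_zero_zero (g : SPerm d) : act 0 g 0 = 0 := by
  funext j; simp [act]

@[simp] theorem shift_zero_left (k : ℕ) (x : Vertex d) : shift k 0 x = x := by
  funext j; simp [shift]

@[simp] theorem shift_zero_right (v : Vertex d) : shift 0 v 0 = v := by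
  funext j; simp [shift]

/-- A reflection acts on the high and low binary digits separately: `2^(m+k) - 1 - (2^k v + x) = 2^k
(2^m - 1 - v) + (2^k - 1 - x)`. -/
theorem act_shift (m k : ℕ) (g : SPerm d) (v x : Vertex d) :
    act (m + k) g (shift k v x) = shift k (act m g v) (act k g x) := by
  funext j
  simp only [act, shift]
  split <;> ring

theorem shift_shift (m k : ℕ) (v x y : Vertex d) :
    shift m (shift k v x) y = shift (k + m) v (shift m x y) := by
  funext j
  simp only [shift]
  ring

/-- At level 0 a reflection is negation, so `act 0 g` is the linear part of every `act k g`. -/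
theorem act_sub_act (k : ℕ) (g : SPerm d) (x y : Vertex d) :
    act k g x - act k g y = act 0 g (x - y) := by
  funext j
  simp only [act, Pi.sub_apply]
  split <;> ring

theorem shift_sub_shift (k : ℕ) (v x y : Vertex d) : shift k v x - shift k v y = x - y := by
  funext j
  simp [shift]

theorem act_injective (k : ℕ) (g : SPerm d) : Function.Injective (act k g) :=
  Function.LeftInverse.injective (act_inv_act k g)

/-! ### Child curves as signed images of the Gray code curve -/

/-- The corner at which the child curve with state `s` starts. -/
def entry (s : SPerm d) : Vertex d := fun j => if s.neg j then 1 else 0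

/-- The corner at which the child curve with state `s` ends. -/
def exit (s : SPerm d) : Vertex d := entry (s * SPerm.flip d)

theorem act_one_zero (s : SPerm d) : act 1 s 0 = entry s := by
  funext j; simp [act, entry]

theorem act_one_entry (g s : SPerm d) : act 1 g (entry s) = entry (g * s) := by
  rw [← act_one_zero, ← act_one_zero, act_mul]

theorem act_one_exit (g s : SPerm d) : act 1 g (exit s) = exit (g * s) := by
  rw [exit, act_one_entry, exit, mul_assoc]

/-- Basic properties of the Gray code curve; it holds in every dimension, and is checked where it
is needed. -/
class GrayFacts (d : ℕ) : Prop where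
  length_eq : (grayCurve d).length = 2 ^ d
  nodup : (grayCurve d).Nodup
  mem_bool : ∀ b : Fin d → Bool, (fun j => if b j then 1 else 0) ∈ grayCurve d
  bool_mem : ∀ v ∈ grayCurve d, ∀ j, v j = 0 ∨ v j = 1
  isChain : (grayCurve d).IsChain IsEdge
  head_eq : (grayCurve d).head? = some 0
  reverse_eq : (grayCurve d).reverse = (grayCurve d).map (act 1 (SPerm.flip d))

instance (v w : Vertex d) : Decidable (IsEdge v w) := inferInstanceAs (Decidable (_ = _))

instance : GrayFacts 3 where
  length_eq := by decide
  nodup := by decide +kernel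
  mem_bool := by decide +kernel
  bool_mem := by decide +kernel
  isChain := by decide +kernel
  head_eq := by decide +kernel
  reverse_eq := by decide +kernel

instance : GrayFacts 4 where
  length_eq := by decide
  nodup := by decide +kernel
  mem_bool := by decide +kernel
  bool_mem := by decide +kernel
  isChain := by decide +kernel
  head_eq := by decide +kernel
  reverse_eq := by decide +kernel

theorem grayCurve_ne_nil (d : ℕ) : grayCurve d ≠ [] := by
  simp [grayCurve]

theorem mem_grayCurve [GrayFacts d] {v : Vertex d} :
    v ∈ grayCurve d ↔ ∀ j, v j = 0 ∨ v j = 1 := by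
  refine ⟨GrayFacts.bool_mem v, fun h => ?_⟩
  convert GrayFacts.mem_bool (fun j => decide (v j = 1)) using 2 with j
  rcases h j with h | h <;> simp [h]

theorem grayCurve_getLast? [GrayFacts d] :
    (grayCurve d).getLast? = some (exit 1) := by
  rw [← List.head?_reverse, GrayFacts.reverse_eq, List.head?_map, GrayFacts.head_eq]
  simp [exit, act_one_zero]

/-- The child curve with state `p.2` of the vertex `p.1`. -/
def block (p : Vertex d × SPerm d) : List (Vertex d) :=
  (grayCurve d).map fun c => shift 1 p.1 (act 1 p.2 c)

/-- The inflation of a sequence of vertices with given states of the child curves. -/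
def inflate (P : List (Vertex d × SPerm d)) : List (Vertex d) := P.flatMap block

/-! ### Placing, reversing and inflating curves with states -/

/-- The reverse of a list if `b` is true. -/
def revIf {α : Type*} (b : Bool) (l : List α) : List α := if b then l.reverse else l

@[simp] theorem revIf_true {α : Type*} (l : List α) : revIf true l = l.reverse := rfl
@[simp] theorem revIf_false {α : Type*} (l : List α) : revIf false l = l := rfl

@[simp] theorem length_revIf {α : Type*} (b : Bool) (l : List α) :
    (revIf b l).length = l.length := by cases b <;> simp

@[simp] theorem mem_revIf {α : Type*} (b : Bool) (l : List α) (x : α) :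
    x ∈ revIf b l ↔ x ∈ l := by cases b <;> simp

theorem map_revIf {α β : Type*} (f : α → β) (b : Bool) (l : List α) :
    (revIf b l).map f = revIf b (l.map f) := by cases b <;> simp

theorem revIf_revIf {α : Type*} (a b : Bool) (l : List α) :
    revIf a (revIf b l) = revIf (xor a b) l := by cases a <;> cases b <;> simp

/-- The image of a curve on the cube of width `2 ^ k` under a signed permutation, possibly
reversed, in the cube of that width represented by `v`. -/
def placeV (k : ℕ) (v : Vertex d) (γ : SPerm d × Bool) (C : List (Vertex d)) : List (Vertex d) :=
  revIf γ.2 (C.map fun x => shift k v (act k γ.1 x))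

/-- The version of `placeV` for curves with states. -/
def place (k : ℕ) (v : Vertex d) (γ : SPerm d × Bool) (P : List (Vertex d × SPerm d)) :
    List (Vertex d × SPerm d) :=
  revIf γ.2 (P.map fun p => (shift k v (act k γ.1 p.1), γ.1 * p.2 * SPerm.flipIf d γ.2))

/-- Composition of signed permutations with reversals. -/
def comp (δ γ : SPerm d × Bool) : SPerm d × Bool := (δ.1 * γ.1, xor δ.2 γ.2)

theorem map_fst_place (k : ℕ) (v : Vertex d) (γ : SPerm d × Bool)
    (P : List (Vertex d × SPerm d)) :
    (place k v γ P).map Prod.fst = placeV k v γ (P.map Prod.fst) := by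
  simp [place, placeV, map_revIf, Function.comp_def]

theorem placeV_placeV (m k : ℕ) (v : Vertex d) (δ γ : SPerm d × Bool) (C : List (Vertex d)) :
    placeV (m + k) 0 δ (placeV k v γ C) = placeV k (act m δ.1 v) (comp δ γ) C := by
  simp [placeV, map_revIf, revIf_revIf, comp, act_shift, act_mul, Function.comp_def]

theorem place_place (m k : ℕ) (v : Vertex d) (δ γ : SPerm d × Bool)
    (P : List (Vertex d × SPerm d)) :
    place (m + k) 0 δ (place k v γ P) = place k (act m δ.1 v) (comp δ γ) P := by
  have h : ∀ s : SPerm d, δ.1 * (γ.1 * s * SPerm.flipIf d γ.2) * SPerm.flipIf d δ.2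
      = δ.1 * γ.1 * s * SPerm.flipIf d (xor δ.2 γ.2) := fun s => by
    rw [Bool.xor_comm, ← SPerm.flipIf_mul]; simp only [mul_assoc]
  simp [place, map_revIf, revIf_revIf, comp, act_shift, act_mul, Function.comp_def, h]

theorem length_place (k : ℕ) (v : Vertex d) (γ : SPerm d × Bool) (P : List (Vertex d × SPerm d)) :
    (place k v γ P).length = P.length := by simp [place]

theorem place_ne_nil {k : ℕ} {v : Vertex d} {γ : SPerm d × Bool}
    {P : List (Vertex d × SPerm d)} (h : P ≠ []) : place k v γ P ≠ [] := by
  rw [← List.length_pos_iff] at *; rwa [length_place]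

theorem block_place (k : ℕ) (v : Vertex d) (g : SPerm d) (p : Vertex d × SPerm d) :
    block (shift k v (act k g p.1), g * p.2) =
      (block p).map fun x => shift (k + 1) v (act (k + 1) g x) := by
  simp [block, act_shift, act_mul, shift_shift, Function.comp_def]

/-- The Gray code curve reversed is its reflection in the last axis, so the reversal of a child
curve is absorbed into its state. -/
theorem block_flip [GrayFacts d] (v : Vertex d) (s : SPerm d) :
    block (v, s * SPerm.flip d) = (block (v, s)).reverse := by
  rw [block, block, ← List.map_reverse, GrayFacts.reverse_eq]
  simp [act_mul, Function.comp_def]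

/-- An isometry of the parent multiplies the states on the left; a reversal of the parent also
reverses every child curve, which is a flip on the right. With this convention in `place`, inflation
commutes with isometries. -/
theorem inflate_place [GrayFacts d] (k : ℕ) (v : Vertex d) (γ : SPerm d × Bool)
    (P : List (Vertex d × SPerm d)) :
    inflate (place k v γ P) = placeV (k + 1) v γ (inflate P) := by
  obtain ⟨g, r⟩ := γ
  cases r
  · simp [inflate, place, placeV, List.flatMap_map, List.map_flatMap, block_place]
  · simp only [inflate, place, placeV, revIf_true, SPerm.flipIf_true, List.flatMap_reverse,
      List.flatMap_map, List.map_flatMap, List.reverse_inj]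
    refine List.flatMap_congr fun p _ => ?_
    simp only [Function.comp_apply, block_flip, List.reverse_reverse, block_place]

theorem length_block [GrayFacts d] (p : Vertex d × SPerm d) : (block p).length = 2 ^ d := by
  simp [block, GrayFacts.length_eq]

theorem block_ne_nil (p : Vertex d × SPerm d) : block p ≠ [] := by
  simp [block, grayCurve_ne_nil]

theorem block_head? [GrayFacts d] (p : Vertex d × SPerm d) :
    (block p).head? = some (shift 1 p.1 (entry p.2)) := by
  simp [block, List.head?_map, GrayFacts.head_eq, act_one_zero]

theorem block_getLast? [GrayFacts d] (p : Vertex d × SPerm d) :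
    (block p).getLast? = some (shift 1 p.1 (exit p.2)) := by
  simp [block, List.getLast?_map, grayCurve_getLast?, act_one_exit]

theorem mem_block [GrayFacts d] (p : Vertex d × SPerm d) (w : Vertex d) :
    w ∈ block p ↔ ∀ j, w j = 2 * p.1 j ∨ w j = 2 * p.1 j + 1 := by
  simp only [block, List.mem_map]
  constructor
  · rintro ⟨c, hc, rfl⟩ j
    rw [mem_grayCurve] at hc
    simp only [shift, act]
    rcases hc (p.2.perm j) with h | h <;> split <;> simp [h]
  · intro h
    refine ⟨act 1 p.2⁻¹ fun j => w j - 2 * p.1 j, mem_grayCurve.2 fun j => ?_, ?_⟩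
    · simp only [act]
      rcases h (p.2⁻¹.perm j) with h | h <;> split <;> omega
    · rw [act_act_inv]
      funext j; simp [shift]

theorem shift_injective (k : ℕ) (v : Vertex d) : Function.Injective (shift k v) := by
  intro x y h
  funext j
  simpa [shift] using congrFun h j

theorem nodup_block [GrayFacts d] (p : Vertex d × SPerm d) : (block p).Nodup :=
  GrayFacts.nodup.map ((shift_injective 1 p.1).comp (act_injective 1 p.2))

/-- The vertices and states of a child curve are determined by the child curve. -/
theorem block_injective [GrayFacts d] : Function.Injective (block (d := d)) := by
  intro p q h
  have h1 : ∀ c ∈ grayCurve d, shift 1 p.1 (act 1 p.2 c) = shift 1 q.1 (act 1 q.2 c) := by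
    simpa [block, List.map_inj_left] using h
  have hv : p.1 = q.1 := by
    funext j
    have h0 := (mem_block p (shift 1 p.1 (entry p.2))).1
      (List.mem_of_mem_head? (by rw [block_head?]; rfl)) j
    have h1 := (mem_block q (shift 1 p.1 (entry p.2))).1
      (h ▸ List.mem_of_mem_head? (by rw [block_head?]; rfl)) j
    omega
  rw [hv] at h1
  have h2 : ∀ c ∈ grayCurve d, act 1 p.2 c = act 1 q.2 c :=
    fun c hc => shift_injective 1 q.1 (h1 c hc)
  have hn : p.2.neg = q.2.neg := by
    funext j
    have := congrFun (h2 0 (mem_grayCurve.2 fun j => Or.inl rfl)) j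
    simp only [act_one_zero, entry] at this
    cases hp : p.2.neg j <;> cases hq : q.2.neg j <;> simp_all
  refine Prod.ext hv (SPerm.ext (Equiv.ext fun j => ?_) hn)
  -- The origin has revealed the reflections; the unit vector along axis `p.2.perm j` reveals the
  -- permutation at `j`.
  have := congrFun (h2 (fun i => if i = p.2.perm j then 1 else 0)
    (mem_grayCurve.2 fun i => by by_cases h : i = p.2.perm j <;> simp [h])) j
  simp only [act, hn] at this
  by_contra hne
  split at this <;> simp [Ne.symm hne] at this

/-! ### Edges, axes and hyperorthogonality under grid isometries -/

theorem isEdge_iff_sub (v w : Vertex d) : IsEdge v w ↔ IsEdge 0 (w - v) := by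
  simp [IsEdge]

theorem isEdge_zero_act (g : SPerm d) (e : Vertex d) : IsEdge 0 (act 0 g e) ↔ IsEdge 0 e := by
  have : ∀ j, (act 0 g e j - (0 : Vertex d) j) ^ 2 = (fun i => (e i) ^ 2) (g.perm j) := fun j => by
    simp only [act]; split <;> simp
  rw [IsEdge, Finset.sum_congr rfl fun j _ => this j, Equiv.sum_comp g.perm fun i => e i ^ 2]
  simp [IsEdge]

theorem isEdge_shift_act (k : ℕ) (v : Vertex d) (g : SPerm d) (x y : Vertex d) :
    IsEdge (shift k v (act k g x)) (shift k v (act k g y)) ↔ IsEdge x y := by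
  rw [isEdge_iff_sub, shift_sub_shift, act_sub_act, isEdge_zero_act, ← isEdge_iff_sub]

theorem axes_map (k : ℕ) (v : Vertex d) (g : SPerm d) (C : List (Vertex d)) :
    axes (C.map fun x => shift k v (act k g x)) = g.perm ⁻¹' axes C := by
  ext j
  simp only [axes, Set.mem_ofPred_eq, Set.mem_preimage]
  have key : ∀ x y : Vertex d, shift k v (act k g x) j ≠ shift k v (act k g y) j ↔
      x (g.perm j) ≠ y (g.perm j) := fun x y => by
    simp only [shift, act]
    split <;> simp
  constructor
  · rintro ⟨a, b, hab, hne⟩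
    obtain ⟨l, hl, he⟩ := List.infix_map_iff.1 hab
    match l, he with
    | [x, y], he =>
      simp only [List.map_cons, List.map_nil, List.cons.injEq, and_true] at he
      rw [he.1, he.2, key] at hne
      exact ⟨x, y, hl, hne⟩
  · rintro ⟨x, y, hxy, hne⟩
    exact ⟨_, _, List.infix_map_iff.2 ⟨[x, y], hxy, rfl⟩, (key x y).2 hne⟩

theorem ncard_axes_map (k : ℕ) (v : Vertex d) (g : SPerm d) (C : List (Vertex d)) :
    (axes (C.map fun x => shift k v (act k g x))).ncard = (axes C).ncard := by
  rw [axes_map, ← Set.ncard_image_of_injective _ g.perm.injective,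
    Set.image_preimage_eq _ g.perm.surjective]

theorem Hyperorthogonal.of_infix {C D : List (Vertex d)} (h : Hyperorthogonal D)
    (hCD : C <:+: D) : Hyperorthogonal C :=
  fun n hn S hS hl => h n hn S (hS.trans hCD) hl

theorem hyperorthogonal_map (k : ℕ) (v : Vertex d) (g : SPerm d) (C : List (Vertex d)) :
    Hyperorthogonal (C.map fun x => shift k v (act k g x)) ↔ Hyperorthogonal C := by
  constructor
  · intro h n hn S hS hl
    rw [← ncard_axes_map k v g]
    exact h n hn _ (List.infix_map_iff.2 ⟨S, hS, rfl⟩) (by simpa using hl)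
  · intro h n hn S hS hl
    obtain ⟨S', hS', rfl⟩ := List.infix_map_iff.1 hS
    rw [ncard_axes_map]
    exact h n hn S' hS' (by simpa using hl)

/-! ### Links between consecutive child curves -/

/-- The two child curves whose states are `1` and `u`, the first one at the origin. -/
def blockPair (u : SPerm d) : List (Vertex d) := block (0, 1) ++ block (exit 1 - entry u, u)

/-- A signed permutation as a list: the coordinates of the image, and whether they are reflected. -/
def code (s : SPerm d) : List (ℕ × Bool) := List.ofFn fun j => ((s.perm j : ℕ), s.neg j)

/-- The codes of the signed permutations that may relate the states of consecutive child curves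
of a hyperorthogonal curve. -/
def stepCodes : ℕ → List (List (ℕ × Bool))
  | 3 => [
      [(0, false), (1, false), (2, false)],
      [(0, false), (1, true), (2, true)],
      [(0, false), (2, false), (1, false)],
      [(0, false), (2, true), (1, true)],
      [(1, false), (0, false), (2, false)],
      [(2, false), (0, false), (1, false)],
      [(1, false), (2, true), (0, true)],
      [(2, false), (1, true), (0, true)]]
  | 4 => [
      [(0, false), (1, false), (2, false), (3, false)],
      [(0, false), (1, false), (2, true), (3, true)],
      [(0, false), (1, false), (3, false), (2, false)],
      [(0, false), (1, false), (3, true), (2, true)],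
      [(0, false), (2, false), (1, false), (3, false)],
      [(0, false), (3, false), (1, false), (2, false)],
      [(0, false), (2, false), (3, true), (1, true)],
      [(0, false), (3, false), (2, true), (1, true)],
      [(1, false), (0, false), (2, false), (3, false)],
      [(1, false), (0, false), (2, true), (3, true)],
      [(1, false), (0, false), (3, false), (2, false)],
      [(1, false), (0, false), (3, true), (2, true)]]
  | _ => []

/-- Child curves with states `s` and `s * u` may follow each other. -/
def IsStep (u : SPerm d) : Prop := code u ∈ stepCodes d

/-- Properties of `IsStep`; they are checked where they are needed. -/
class StepFacts (d : ℕ) : Prop where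
  isStep_iff : ∀ u : SPerm d,
    IsStep u ↔ IsEdge 0 (exit 1 - entry u) ∧ Hyperorthogonal (blockPair u)
  isStep_one : IsStep (1 : SPerm d)
  isStep_reverse : ∀ u : SPerm d, IsStep u → IsStep (SPerm.flip d * u⁻¹ * SPerm.flip d)

/-- The vertex `q.1` with a child curve of state `q.2` may follow the vertex `p.1` with a child
curve of state `p.2`. -/
def Link (p q : Vertex d × SPerm d) : Prop :=
  q.1 - p.1 = exit p.2 - entry q.2 ∧ IsStep (p.2⁻¹ * q.2)

theorem Link.map {p q : Vertex d × SPerm d} (h : Link p q) (k : ℕ) (v : Vertex d) (g : SPerm d) :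
    Link (shift k v (act k g p.1), g * p.2) (shift k v (act k g q.1), g * q.2) := by
  refine ⟨?_, by simpa [mul_assoc] using h.2⟩
  rw [shift_sub_shift, act_sub_act, h.1, ← act_sub_act 1, act_one_exit, act_one_entry]

theorem Link.reverse [StepFacts d] {p q : Vertex d × SPerm d} (h : Link p q) :
    Link (q.1, q.2 * SPerm.flip d) (p.1, p.2 * SPerm.flip d) := by
  refine ⟨?_, ?_⟩
  · have h1 := h.1
    simp only [exit, mul_assoc, SPerm.flip_mul_flip, mul_one] at h1 ⊢
    rw [← neg_sub, h1, neg_sub]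
  · have := StepFacts.isStep_reverse _ h.2
    have hf : (SPerm.flip d)⁻¹ = SPerm.flip d := inv_eq_of_mul_eq_one_left SPerm.flip_mul_flip
    simpa [mul_assoc, hf] using this

theorem isChain_place [StepFacts d] (k : ℕ) (v : Vertex d) (γ : SPerm d × Bool)
    {P : List (Vertex d × SPerm d)} (h : P.IsChain Link) : (place k v γ P).IsChain Link := by
  obtain ⟨g, r⟩ := γ
  cases r
  · simp only [place, revIf_false, SPerm.flipIf_false, mul_one]
    exact List.isChain_map_of_isChain _ (fun p q hpq => hpq.map k v g) h
  · simp only [place, revIf_true, SPerm.flipIf_true, List.isChain_reverse]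
    exact List.isChain_map_of_isChain _ (fun p q hpq => (hpq.map k v g).reverse) h

theorem block_append_block (p q : Vertex d × SPerm d) (h : q.1 - p.1 = exit p.2 - entry q.2) :
    block p ++ block q =
      (blockPair (p.2⁻¹ * q.2)).map fun x => shift 1 p.1 (act 1 p.2 x) := by
  have h1 := block_place 0 p.1 p.2 (0, 1)
  have h2 := block_place 0 p.1 p.2 (exit 1 - entry (p.2⁻¹ * q.2), p.2⁻¹ * q.2)
  simp only [mul_inv_cancel_left, mul_one, act_zero_zero, shift_zero_right, zero_add] at h1 h2
  rw [← act_sub_act 1, act_one_exit, act_one_entry, mul_inv_cancel_left, mul_one, ← h] at h2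
  rw [blockPair, List.map_append, ← h1, ← h2]
  congr 2
  refine Prod.ext ?_ rfl
  funext j
  simp [shift]

/-- Undoing the state of the first child curve moves the pair to a `blockPair`, which depends on the
relative state only; being an edge and being hyperorthogonal survive this isometry. -/
theorem link_iff [StepFacts d] (p q : Vertex d × SPerm d)
    (h : q.1 - p.1 = exit p.2 - entry q.2) :
    Link p q ↔ IsEdge p.1 q.1 ∧ Hyperorthogonal (block p ++ block q) := by
  rw [block_append_block p q h, hyperorthogonal_map, Link, StepFacts.isStep_iff,
    isEdge_iff_sub p.1, h, ← isEdge_zero_act p.2, ← act_sub_act 1, act_one_exit, act_one_entry,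
    mul_inv_cancel_left, mul_one]
  simp

theorem Link.isEdge [StepFacts d] {p q : Vertex d × SPerm d} (h : Link p q) : IsEdge p.1 q.1 :=
  ((link_iff p q h.1).1 h).1

theorem Link.hyperorthogonal [StepFacts d] {p q : Vertex d × SPerm d} (h : Link p q) :
    Hyperorthogonal (block p ++ block q) :=
  ((link_iff p q h.1).1 h).2

/-- The trivial step is allowed, so each child curve is the first half of a hyperorthogonal pair. -/
theorem hyperorthogonal_block [StepFacts d] (p : Vertex d × SPerm d) :
    Hyperorthogonal (block p) := by
  have : Link p (p.1 + (exit p.2 - entry p.2), p.2) :=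
    ⟨by simp, by simpa using StepFacts.isStep_one⟩
  exact this.hyperorthogonal.of_infix List.infix_append_left

/-- Hyperorthogonality is local: a window of `2 ^ n + 1` vertices with `n + 2 ≤ d` is too short to
meet three child curves, each of which has `2 ^ d` vertices. -/
theorem hyperorthogonal_inflate [GrayFacts d] [StepFacts d] :
    ∀ {P : List (Vertex d × SPerm d)}, P.IsChain Link → Hyperorthogonal (inflate P)
  | [], _ => fun n _ S hS hl => by
    simp only [inflate, List.flatMap_nil, List.infix_nil] at hS
    simp [hS] at hl
  | [p], _ => by simpa [inflate] using hyperorthogonal_block p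
  | p :: q :: P, h => by
    intro n hn S hS hl
    rw [List.isChain_cons_cons] at h
    have ih := hyperorthogonal_inflate h.2
    have he : inflate (p :: q :: P) = block p ++ inflate (q :: P) := by simp [inflate]
    rw [he, List.infix_append_iff] at hS
    rcases hS with hS | hS | ⟨a, b, rfl, ha, hb⟩
    · exact hyperorthogonal_block p n hn S hS hl
    · exact ih n hn S hS hl
    · rcases eq_or_ne a [] with rfl | ha0
      · exact ih n hn _ (by simpa using hb.isInfix) hl
      · have hb' : b <+: block q := by
          have hq : block q <+: inflate (q :: P) := by simp [inflate]
          -- At least one vertex of the window lies in `block p`, so at most `2 ^ n ≤ 2 ^ d` remain,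
          -- and these fit into `block q`.
          refine List.prefix_of_prefix_length_le hb hq ?_
          have h1 := List.length_pos_iff.2 ha0
          have h2 : 2 ^ n ≤ 2 ^ d := Nat.pow_le_pow_right (by norm_num) (by omega)
          rw [length_block]
          rw [List.length_append] at hl
          omega
        refine h.1.hyperorthogonal n hn _ ?_ hl
        rw [List.infix_append_iff]
        exact Or.inr (Or.inr ⟨a, b, rfl, ha, hb'⟩)

/-! ### Inflation of a chain of linked states -/

theorem isChain_block [GrayFacts d] (p : Vertex d × SPerm d) : (block p).IsChain IsEdge :=
  List.isChain_map_of_isChain _ (fun x y h => (isEdge_shift_act 1 p.1 p.2 x y).2 h)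
    GrayFacts.isChain

theorem isCurve_block [GrayFacts d] (p : Vertex d × SPerm d) : IsCurve (block p) :=
  ⟨block_ne_nil p, nodup_block p, isChain_block p⟩

/-- Doubling doubles the edge, and the corner condition takes one copy away again, so the edge keeps
its direction. -/
theorem Link.shift_entry_sub {p q : Vertex d × SPerm d} (h : Link p q) :
    shift 1 q.1 (entry q.2) - shift 1 p.1 (exit p.2) = q.1 - p.1 := by
  have h1 := h.1
  funext j
  have := congrFun h1 j
  simp only [shift, Pi.sub_apply] at this ⊢
  linarith

theorem isIsometricImage_block (p : Vertex d × SPerm d) :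
    IsIsometricImage (grayCurve d) (block p) :=
  ⟨fun c => shift 1 p.1 (act 1 p.2 c), ⟨p.2.perm, fun j => if p.2.neg j then -1 else 1,
    fun j => 2 * p.1 j + if p.2.neg j then 1 else 0, fun v j => by
      simp only [shift, act]
      split <;> simp <;> ring⟩, Or.inl rfl⟩

theorem isInflation_inflate [GrayFacts d] {P : List (Vertex d × SPerm d)} (h : P.IsChain Link) :
    IsInflation (IsIsometricImage (grayCurve d)) (P.map Prod.fst) (inflate P) := by
  refine ⟨P.map fun p => (p.1, block p), by simp [Function.comp_def],
    by simp [inflate, List.flatMap_map], ?_, ?_⟩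
  · simp only [List.mem_map, forall_exists_index, and_imp]
    rintro _ p _ rfl
    exact ⟨isCurve_block p, mem_block p, isIsometricImage_block p⟩
  · refine List.isChain_map_of_isChain _ (fun p q hpq => ?_) h
    simp only [block_getLast?, block_head?, Option.mem_some_iff]
    rintro _ rfl _ rfl
    exact hpq.shift_entry_sub

theorem isChain_inflate [GrayFacts d] [StepFacts d] {P : List (Vertex d × SPerm d)}
    (h : P.IsChain Link) : (inflate P).IsChain IsEdge := by
  rw [inflate, List.flatMap_def, List.isChain_flatten (by simp [block_ne_nil])]
  refine ⟨fun l hl => ?_, ?_⟩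
  · obtain ⟨p, _, rfl⟩ := List.mem_map.1 hl
    exact isChain_block p
  refine List.isChain_map_of_isChain _ (fun p q hpq => ?_) h
  simp only [block_getLast?, block_head?, Option.mem_some_iff]
  rintro _ rfl _ rfl
  rw [isEdge_iff_sub, hpq.shift_entry_sub, ← isEdge_iff_sub]
  exact hpq.isEdge

theorem nodup_inflate [GrayFacts d] {P : List (Vertex d × SPerm d)}
    (h : (P.map Prod.fst).Nodup) : (inflate P).Nodup := by
  rw [inflate, List.nodup_flatMap]
  refine ⟨fun p _ => nodup_block p, ?_⟩
  refine (List.pairwise_map.1 h).imp fun {p q} hpq => ?_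
  intro w hp hq
  refine hpq (funext fun j => ?_)
  have h1 := (mem_block p w).1 hp j
  have h2 := (mem_block q w).1 hq j
  omega

theorem mem_inflate [GrayFacts d] {P : List (Vertex d × SPerm d)} (w : Vertex d) :
    w ∈ inflate P ↔ (fun j => w j / 2) ∈ P.map Prod.fst := by
  simp only [inflate, List.mem_flatMap, List.mem_map, mem_block]
  refine exists_congr fun p => and_congr_right fun _ => ?_
  rw [funext_iff]
  exact forall_congr' fun j => by omega

theorem length_inflate [GrayFacts d] (P : List (Vertex d × SPerm d)) :
    (inflate P).length = 2 ^ d * P.length := by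
  induction P with
  | nil => simp [inflate]
  | cons p P ih =>
    have : inflate (p :: P) = block p ++ inflate P := by simp [inflate]
    rw [this, List.length_append, ih, length_block, List.length_cons]
    ring

/-- The states of the child curves are determined by the curve. -/
theorem inflate_injective [GrayFacts d] : Function.Injective (inflate (d := d))
  | [], [], _ => rfl
  | [], q :: Q, h => by
    have := congrArg List.length h
    simp [length_inflate] at this
  | p :: P, [], h => by
    have := congrArg List.length h
    simp [length_inflate] at this
  | p :: P, q :: Q, h => by
    have h' : block p ++ inflate P = block q ++ inflate Q := by simpa [inflate] using h
    obtain ⟨h1, h2⟩ := List.append_inj h' (by simp [length_block])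
    rw [block_injective h1, inflate_injective h2]

/-! ### Positions of vertices in approximating sequences -/

theorem getElem?_flatten_of_length_eq {α : Type*} {n : ℕ} (hn : 0 < n) :
    ∀ {L : List (List α)}, (∀ l ∈ L, l.length = n) → ∀ i,
      L.flatten[i]? = L[i / n]?.bind fun l => l[i % n]?
  | [], _, i => by simp
  | l :: L, h, i => by
    have hl : l.length = n := h l (by simp)
    rw [List.flatten_cons]
    rcases lt_or_ge i n with hi | hi
    · rw [List.getElem?_append_left (by omega), Nat.div_eq_of_lt hi, Nat.mod_eq_of_lt hi]
      simp
    · rw [List.getElem?_append_right (by omega), hl,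
        getElem?_flatten_of_length_eq hn (fun l' h' => h l' (List.mem_cons_of_mem _ h')),
        Nat.div_eq_sub_div hn hi, List.getElem?_cons_succ, Nat.mod_eq_sub_mod hi]

theorem length_flatten_of_length_eq {α : Type*} {n : ℕ} {L : List (List α)}
    (h : ∀ l ∈ L, l.length = n) : L.flatten.length = n * L.length := by
  rw [List.length_flatten, List.map_congr_left h]
  simp [mul_comm]

theorem length_of_mem_iff {C : List (Vertex d)} (hC : C.Nodup) {v : Vertex d}
    (h : ∀ w, w ∈ C ↔ ∀ j, w j = 2 * v j ∨ w j = 2 * v j + 1) : C.length = 2 ^ d := by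
  have : C.toFinset = Fintype.piFinset fun j => ({2 * v j, 2 * v j + 1} : Finset ℤ) := by
    ext w; simp [h]
  rw [← List.toFinset_card_of_nodup hC, this, Fintype.card_piFinset]
  simp

theorem IsInflation.length_eq {ok : List (Vertex d) → Prop} {P Q : List (Vertex d)}
    (h : IsInflation ok P Q) : Q.length = 2 ^ d * P.length := by
  obtain ⟨L, rfl, rfl, hL, -⟩ := h
  rw [List.flatMap_def, length_flatten_of_length_eq (n := 2 ^ d)]
  · simp
  · intro l hl
    obtain ⟨p, hp, rfl⟩ := List.mem_map.1 hl
    exact length_of_mem_iff (hL p hp).1.2.1 (hL p hp).2.1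

/-- All child curves have `2 ^ d` vertices, so integer division of the position finds the parent, as
does halving the coordinates. Hence an inflation determines its parent curve. -/
theorem IsInflation.getElem?_half {ok : List (Vertex d) → Prop} {P Q : List (Vertex d)}
    (h : IsInflation ok P Q) {i : ℕ} {v : Vertex d} (hi : Q[i]? = some v) :
    P[i / 2 ^ d]? = some fun j => v j / 2 := by
  obtain ⟨L, rfl, rfl, hL, -⟩ := h
  rw [List.flatMap_def, getElem?_flatten_of_length_eq (n := 2 ^ d) (by positivity)] at hi
  · rw [List.getElem?_map] at hi ⊢
    obtain ⟨C, hC, hv⟩ := Option.bind_eq_some_iff.1 hi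
    obtain ⟨p, hp, rfl⟩ := Option.map_eq_some_iff.1 hC
    rw [hp, Option.map_some, Option.some_inj]
    have hpL := List.mem_of_getElem? hp
    have := ((hL p hpL).2.1 v).1 (List.mem_of_getElem? hv)
    funext j
    have := this j
    omega
  · intro l hl
    obtain ⟨p, hp, rfl⟩ := List.mem_map.1 hl
    exact length_of_mem_iff (hL p hp).1.2.1 (hL p hp).2.1

/-- A sequence of curves that satisfies the conditions on approximating curves. -/
structure IsApproximation (A : ℕ → List (Vertex d)) : Prop where
  zero : A 0 = [0]
  kCurve : ∀ k, IsKCurve k (A k)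
  inflation : ∀ k, IsInflation (fun _ => True) (A k) (A (k + 1))

theorem Approximates.isApproximation {A : ℕ → List (Vertex d)}
    {f : unitInterval → EuclideanSpace ℝ (Fin d)} (h : Approximates A f) : IsApproximation A :=
  ⟨h.zero, h.kCurve, h.inflation⟩

namespace IsApproximation

variable {A : ℕ → List (Vertex d)}

theorem length_eq (h : IsApproximation A) : ∀ k, (A k).length = 2 ^ (d * k)
  | 0 => by simp [h.zero]
  | k + 1 => by
    rw [(h.inflation k).length_eq, h.length_eq k, ← pow_add]
    congr 1; ring

theorem getElem?_div (h : IsApproximation A) (k : ℕ) : ∀ (m : ℕ) {i : ℕ} {v : Vertex d},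
    (A (k + m))[i]? = some v → (A k)[i / 2 ^ (d * m)]? = some fun j => v j / 2 ^ m
  | 0, i, v, hi => by simpa using hi
  | m + 1, i, v, hi => by
    have h1 := (h.inflation (k + m)).getElem?_half hi
    have h2 := h.getElem?_div k m h1
    rw [Nat.div_div_eq_div_mul, ← pow_add] at h2
    rw [mul_add, mul_one, add_comm, h2, Option.some_inj]
    funext j
    rw [Int.ediv_ediv_of_nonneg (by norm_num), pow_succ, mul_comm]

/-- Dividing coordinates by `2 ^ k` leads to the only vertex `0` of `A 0`, which confines `A k` to
the standard cube; a cube of the same width inside it has corner `t = 0`. -/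
theorem mem_iff (h : IsApproximation A) (k : ℕ) (v : Vertex d) :
    v ∈ A k ↔ ∀ j, 0 ≤ v j ∧ v j < 2 ^ k := by
  have h1 : ∀ v ∈ A k, ∀ j, 0 ≤ v j ∧ v j < 2 ^ k := by
    intro v hv j
    obtain ⟨i, hi⟩ := List.getElem?_of_mem hv
    have h2 := h.getElem?_div 0 k (by rwa [zero_add])
    rw [h.zero] at h2
    have h3 := congrFun (List.mem_singleton.1 (List.mem_of_getElem? h2)) j
    simp only [Pi.zero_apply] at h3
    have hp : (0 : ℤ) < 2 ^ k := by positivity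
    constructor
    · by_contra hneg
      have := Int.ediv_neg_of_neg_of_pos (not_le.1 hneg) hp
      omega
    · have := Int.lt_ediv_add_one_mul_self (v j) hp
      rw [h3] at this
      simpa using this
  obtain ⟨t, ht⟩ := (h.kCurve k).2
  have hp : (0 : ℤ) < 2 ^ k := by positivity
  have ht0 : ∀ j, t j = 0 := fun j => by
    have a := (h1 t ((ht t).2 fun j => ⟨le_rfl, by omega⟩) j).1
    have b := (h1 (fun j => t j + (2 ^ k - 1)) ((ht _).2 fun j => ⟨by omega, by omega⟩) j).2
    omega
  rw [ht]
  simp [ht0]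

end IsApproximation

/-! ### Curves generated by a list of images -/

/-- The sequence of curves with states in which each curve consists of images of its predecessor
under the given signed permutations and reversals, along the Gray code curve. -/
def pattern (D : List (SPerm d × Bool)) : ℕ → List (Vertex d × SPerm d)
  | 0 => [(0, 1)]
  | k + 1 => ((grayCurve d).zip D).flatMap fun q => place k q.1 q.2 (pattern D k)

theorem block_zero_one : block ((0, 1) : Vertex d × SPerm d) = grayCurve d := by
  simp [block]

/-- Since inflation commutes with placing, the claim passes from one level to the next; at the
start, the child curve with state `1` is the Gray code curve. So the states carried along are those
of the child curves in the next level. -/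
theorem inflate_pattern [GrayFacts d] {D : List (SPerm d × Bool)} (hD : D.length = 2 ^ d) :
    ∀ k, inflate (pattern D k) = (pattern D (k + 1)).map Prod.fst
  | 0 => by
    have h : ((grayCurve d).zip D).map Prod.fst = grayCurve d :=
      List.map_fst_zip (by rw [hD, GrayFacts.length_eq])
    have h2 : ∀ q : Vertex d × (SPerm d × Bool),
        (place 0 q.1 q.2 [(0, 1)]).map Prod.fst = [q.1] := by
      rintro ⟨v, g, r⟩
      cases r <;> simp [place]
    simp only [pattern, List.map_flatMap, h2]
    rw [← List.map_eq_flatMap, h]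
    simp [inflate, block_zero_one]
  | k + 1 => by
    have h : ∀ D k, pattern (d := d) D (k + 1) =
      ((grayCurve d).zip D).flatMap fun q => place k q.1 q.2 (pattern D k) := fun _ _ => rfl
    rw [h D (k + 1), List.map_flatMap]
    simp only [map_fst_place, ← inflate_pattern hD k, ← inflate_place]
    rw [h D k, inflate, List.flatMap_assoc]
    rfl

/-- The states of the first and the last vertex of the image of a curve under `γ`, given those of
the curve. -/
def ends (γ : SPerm d × Bool) (e : SPerm d × SPerm d) : SPerm d × SPerm d :=
  if γ.2 then (γ.1 * e.2 * SPerm.flip d, γ.1 * e.1 * SPerm.flip d) else (γ.1 * e.1, γ.1 * e.2)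

/-- `e` are the states of the first and the last vertex of `P`. -/
def HasEnds (P : List (Vertex d × SPerm d)) (e : SPerm d × SPerm d) : Prop :=
  P.head?.map Prod.snd = some e.1 ∧ P.getLast?.map Prod.snd = some e.2

theorem HasEnds.ne_nil {P : List (Vertex d × SPerm d)} {e : SPerm d × SPerm d}
    (h : HasEnds P e) : P ≠ [] := by
  rintro rfl
  simp [HasEnds] at h

theorem HasEnds.place {P : List (Vertex d × SPerm d)} {e : SPerm d × SPerm d}
    (h : HasEnds P e) (k : ℕ) (v : Vertex d) (γ : SPerm d × Bool) :
    HasEnds (place k v γ P) (ends γ e) := by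
  obtain ⟨g, r⟩ := γ
  obtain ⟨h1, h2⟩ := h
  obtain ⟨p, hp, hp'⟩ := Option.map_eq_some_iff.1 h1
  obtain ⟨q, hq, hq'⟩ := Option.map_eq_some_iff.1 h2
  cases r <;>
    simp [HasEnds, GridCurve.place, ends, List.head?_map, List.getLast?_map, hp, hq, hp', hq']

theorem HasEnds.flatMap {α : Type*} {L : List α} {f : α → List (Vertex d × SPerm d)}
    {E : α → SPerm d × SPerm d} (h : ∀ q ∈ L, HasEnds (f q) (E q)) {a b : α}
    (ha : L.head? = some a) (hb : L.getLast? = some b) :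
    HasEnds (L.flatMap f) ((E a).1, (E b).2) := by
  obtain ⟨L', rfl⟩ : ∃ L', L = a :: L' := by
    cases L with
    | nil => simp at ha
    | cons x L' => exact ⟨L', by simpa using ha⟩
  constructor
  · have ha := h a (by simp)
    rw [List.flatMap_cons, List.head?_append_of_ne_nil _ ha.ne_nil]
    exact ha.1
  · obtain ⟨L'', hL''⟩ := List.getLast?_eq_some_iff.1 hb
    rw [hL''] at h ⊢
    have hb := h b (by simp)
    rw [List.flatMap_append, List.flatMap_cons, List.flatMap_nil, List.append_nil,
      List.getLast?_append_of_ne_nil _ hb.ne_nil]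
    exact hb.2

/-- The images of a curve with end states `e` fit together along the Gray code curve. -/
def Fits (D : List (SPerm d × Bool)) (e : SPerm d × SPerm d) : Prop :=
  ((grayCurve d).zip D).IsChain fun q q' =>
    Link (q.1, (ends q.2 e).2) (q'.1, (ends q'.2 e).1)

/-- A sufficient condition for `pattern D` to consist of curves of the required kind: the set `R`
contains the end states of all curves. -/
structure IsAdmissible (D : List (SPerm d × Bool)) (R : Set (SPerm d × SPerm d)) : Prop where
  length_eq : D.length = 2 ^ d
  one_mem : (1, 1) ∈ R
  fits : ∀ e ∈ R, Fits D e
  next_mem : ∀ e ∈ R, ∀ a ∈ D.head?, ∀ b ∈ D.getLast?, ((ends a e).1, (ends b e).2) ∈ R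

theorem zip_head?_getLast? [GrayFacts d] {D : List (SPerm d × Bool)} (hD : D.length = 2 ^ d) :
    ∃ p q, ((grayCurve d).zip D).head? = some p ∧ ((grayCurve d).zip D).getLast? = some q ∧
      D.head? = some p.2 ∧ D.getLast? = some q.2 := by
  have h : ((grayCurve d).zip D).map Prod.snd = D :=
    List.map_snd_zip (by rw [hD, GrayFacts.length_eq])
  have hne : (grayCurve d).zip D ≠ [] := by
    intro h0
    rw [h0] at h
    rw [← h] at hD
    have : 0 < 2 ^ d := by positivity
    simp at hD
    omega
  refine ⟨_, _, List.head?_eq_some_head hne, List.getLast?_eq_some_getLast hne, ?_, ?_⟩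
  · conv_lhs => rw [← h]
    rw [List.head?_map, List.head?_eq_some_head hne]; rfl
  · conv_lhs => rw [← h]
    rw [List.getLast?_map, List.getLast?_eq_some_getLast hne]; rfl

/-- Only the first and the last image contribute, so the end states obey a recursion that ignores
the interior of the curve. -/
theorem hasEnds_pattern_succ [GrayFacts d] {D : List (SPerm d × Bool)} (hD : D.length = 2 ^ d)
    {k : ℕ} {e : SPerm d × SPerm d} (he : HasEnds (pattern D k) e) {a b : SPerm d × Bool}
    (ha : D.head? = some a) (hb : D.getLast? = some b) :
    HasEnds (pattern D (k + 1)) ((ends a e).1, (ends b e).2) := by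
  obtain ⟨p, q, hp, hq, hp', hq'⟩ := zip_head?_getLast? hD
  rw [ha, Option.some_inj] at hp'
  rw [hb, Option.some_inj] at hq'
  rw [hp', hq']
  exact HasEnds.flatMap (E := fun q => ends q.2 e) (fun q _ => he.place k q.1 q.2) hp hq

theorem hasEnds_pattern [GrayFacts d] {D : List (SPerm d × Bool)}
    {R : Set (SPerm d × SPerm d)} (h : IsAdmissible D R) :
    ∀ k, ∃ e ∈ R, HasEnds (pattern D k) e
  | 0 => ⟨(1, 1), h.one_mem, by simp [HasEnds, pattern]⟩
  | k + 1 => by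
    obtain ⟨e, he, hk⟩ := hasEnds_pattern h k
    obtain ⟨p, q, -, -, hp', hq'⟩ := zip_head?_getLast? h.length_eq
    exact ⟨_, h.next_mem e he _ hp' _ hq', hasEnds_pattern_succ h.length_eq hk hp' hq'⟩

theorem inflate_getLast? [GrayFacts d] {P : List (Vertex d × SPerm d)} {x : Vertex d × SPerm d}
    (h : P.getLast? = some x) :
    (inflate P).getLast? = some (shift 1 x.1 (exit x.2)) := by
  obtain ⟨P', rfl⟩ := List.getLast?_eq_some_iff.1 h
  rw [inflate, List.flatMap_append, List.flatMap_cons, List.flatMap_nil, List.append_nil,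
    List.getLast?_append_of_ne_nil _ (block_ne_nil _), block_getLast?]

theorem inflate_head? [GrayFacts d] {P : List (Vertex d × SPerm d)} {x : Vertex d × SPerm d}
    (h : P.head? = some x) :
    (inflate P).head? = some (shift 1 x.1 (entry x.2)) := by
  cases P with
  | nil => simp at h
  | cons y P =>
    obtain rfl : y = x := by simpa using h
    rw [inflate, List.flatMap_cons, List.head?_append_of_ne_nil _ (block_ne_nil _), block_head?]

theorem HasEnds.link {P Q : List (Vertex d × SPerm d)} {e e' : SPerm d × SPerm d}
    (hP : HasEnds P e) (hQ : HasEnds Q e') {v w : Vertex d} (hl : Link (v, e.2) (w, e'.1))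
    {x y : Vertex d × SPerm d} (hx : P.getLast? = some x) (hy : Q.head? = some y)
    (hxy : y.1 - x.1 = w - v) : Link x y := by
  have h1 := hP.2
  have h2 := hQ.1
  rw [hx, Option.map_some, Option.some_inj] at h1
  rw [hy, Option.map_some, Option.some_inj] at h2
  refine ⟨?_, ?_⟩
  · rw [hxy, h1, h2]; exact hl.1
  · rw [h1, h2]; exact hl.2

/-- Consecutive images of the `k`-th curve are connected by edges of the Gray code curve. -/
def Connected (D : List (SPerm d × Bool)) (k : ℕ) : Prop :=
  ((grayCurve d).zip D).IsChain fun q q' =>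
    ∀ x ∈ (place k q.1 q.2 (pattern D k)).getLast?,
      ∀ y ∈ (place k q'.1 q'.2 (pattern D k)).head?, y.1 - x.1 = q'.1 - q.1

theorem exists_hasEnds_pattern [GrayFacts d] {D : List (SPerm d × Bool)}
    (hD : D.length = 2 ^ d) : ∀ k, ∃ e, HasEnds (pattern D k) e
  | 0 => ⟨(1, 1), by simp [HasEnds, pattern]⟩
  | k + 1 => by
    obtain ⟨e, hk⟩ := exists_hasEnds_pattern hD k
    obtain ⟨p, q, -, -, hp', hq'⟩ := zip_head?_getLast? hD
    exact ⟨_, hasEnds_pattern_succ hD hk hp' hq'⟩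

theorem connected_zero (D : List (SPerm d × Bool)) : Connected D 0 := by
  refine List.isChain_iff_forall_rel_of_append_cons_cons.2 fun {q q'} _ _ _ x hx y hy => ?_
  have hx' := List.mem_of_getLast? hx
  have hy' := List.mem_of_mem_head? hy
  simp only [place, pattern, mem_revIf, List.map_cons, List.map_nil, List.mem_singleton,
    act_zero_zero, shift_zero_right] at hx' hy'
  rw [hx', hy']

/-- `Link` sees positions only through their difference. By `Connected` the end vertices of
consecutive images differ by the Gray code edge, so they can be replaced by the Gray code vertices,
and only end states matter. -/
theorem Connected.fits [GrayFacts d] {D : List (SPerm d × Bool)} {k : ℕ} (hk : Connected D k)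
    {e : SPerm d × SPerm d} (he : HasEnds (pattern D k) e)
    (h : ((grayCurve d).zip D).IsChain fun q q' =>
      ∀ x ∈ (place k q.1 q.2 (pattern D k)).getLast?,
        ∀ y ∈ (place k q'.1 q'.2 (pattern D k)).head?, Link x y) : Fits D e := by
  rw [Connected, List.isChain_iff_getElem] at hk
  rw [List.isChain_iff_getElem] at h
  rw [Fits, List.isChain_iff_getElem]
  intro i hi
  have hx := List.getLast?_eq_some_getLast (place_ne_nil (k := k)
    (v := ((grayCurve d).zip D)[i].1) (γ := ((grayCurve d).zip D)[i].2) he.ne_nil)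
  have hy := List.head?_eq_some_head (place_ne_nil (k := k)
    (v := ((grayCurve d).zip D)[i + 1].1) (γ := ((grayCurve d).zip D)[i + 1].2) he.ne_nil)
  have h1 := hk i hi _ hx _ hy
  have h2 := h i hi _ hx _ hy
  have h3 := (he.place k ((grayCurve d).zip D)[i].1 ((grayCurve d).zip D)[i].2).2
  have h4 := (he.place k ((grayCurve d).zip D)[i + 1].1 ((grayCurve d).zip D)[i + 1].2).1
  rw [hx, Option.map_some, Option.some_inj] at h3
  rw [hy, Option.map_some, Option.some_inj] at h4
  rw [← h3, ← h4]
  exact ⟨h1 ▸ h2.1, h2.2⟩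

theorem Connected.isChain_link [GrayFacts d] {D : List (SPerm d × Bool)} {k : ℕ}
    (hk : Connected D k) {e : SPerm d × SPerm d} (he : HasEnds (pattern D k) e)
    (h : Fits D e) : ((grayCurve d).zip D).IsChain fun q q' =>
      ∀ x ∈ (place k q.1 q.2 (pattern D k)).getLast?,
        ∀ y ∈ (place k q'.1 q'.2 (pattern D k)).head?, Link x y := by
  rw [Connected, List.isChain_iff_getElem] at hk
  rw [Fits, List.isChain_iff_getElem] at h
  rw [List.isChain_iff_getElem]
  intro i hi x hx y hy
  exact (he.place k _ _).link (he.place k _ _) (h i hi) hx hy (hk i hi x hx y hy)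

/-- The end vertices at level `k + 1` are the end corners of the outermost child curves, and linked
child curves preserve the direction of the edge (`Link.shift_entry_sub`). -/
theorem Connected.succ [GrayFacts d] {D : List (SPerm d × Bool)} (hD : D.length = 2 ^ d) {k : ℕ}
    (hk : Connected D k) (h : ((grayCurve d).zip D).IsChain fun q q' =>
      ∀ x ∈ (place k q.1 q.2 (pattern D k)).getLast?,
        ∀ y ∈ (place k q'.1 q'.2 (pattern D k)).head?, Link x y) : Connected D (k + 1) := by
  obtain ⟨e₀, hE₀⟩ := exists_hasEnds_pattern hD k
  rw [Connected, List.isChain_iff_getElem] at hk ⊢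
  rw [List.isChain_iff_getElem] at h
  intro i hi x hx y hy
  set q := ((grayCurve d).zip D)[i]
  set q' := ((grayCurve d).zip D)[i + 1]
  have key : ∀ q : Vertex d × (SPerm d × Bool),
      (place (k + 1) q.1 q.2 (pattern D (k + 1))).map Prod.fst =
        inflate (place k q.1 q.2 (pattern D k)) := fun q => by
    rw [map_fst_place, ← inflate_pattern hD, inflate_place]
  obtain ⟨x', hx'⟩ : ∃ x', (place k q.1 q.2 (pattern D k)).getLast? = some x' :=
    ⟨_, List.getLast?_eq_some_getLast (place_ne_nil hE₀.ne_nil)⟩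
  obtain ⟨y', hy'⟩ : ∃ y', (place k q'.1 q'.2 (pattern D k)).head? = some y' :=
    ⟨_, List.head?_eq_some_head (place_ne_nil hE₀.ne_nil)⟩
  have hx1 := congrArg List.getLast? (key q)
  rw [List.getLast?_map, hx, inflate_getLast? hx', Option.map_some, Option.some_inj] at hx1
  have hy1 := congrArg List.head? (key q')
  rw [List.head?_map, hy, inflate_head? hy', Option.map_some, Option.some_inj] at hy1
  rw [hx1, hy1, (h i hi x' hx' y' hy').shift_entry_sub, hk i hi x' hx' y' hy']

theorem isChain_pattern_succ_iff [GrayFacts d] [StepFacts d] {D : List (SPerm d × Bool)}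
    (hD : D.length = 2 ^ d) {k : ℕ} : (pattern D (k + 1)).IsChain Link ↔
      (∀ q ∈ (grayCurve d).zip D, (place k q.1 q.2 (pattern D k)).IsChain Link) ∧
      ((grayCurve d).zip D).IsChain fun q q' =>
        ∀ x ∈ (place k q.1 q.2 (pattern D k)).getLast?,
          ∀ y ∈ (place k q'.1 q'.2 (pattern D k)).head?, Link x y := by
  obtain ⟨e₀, hE₀⟩ := exists_hasEnds_pattern hD k
  rw [pattern, List.flatMap_def, List.isChain_flatten, List.isChain_map]
  · simp only [List.forall_mem_map]
  · intro hl
    obtain ⟨q, _, hq⟩ := List.mem_map.1 hl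
    exact place_ne_nil hE₀.ne_nil hq

theorem connected_of_isAdmissible [GrayFacts d] {D : List (SPerm d × Bool)}
    {R : Set (SPerm d × SPerm d)} (h : IsAdmissible D R) : ∀ k, Connected D k
  | 0 => connected_zero D
  | k + 1 => by
    obtain ⟨e, he, hE⟩ := hasEnds_pattern h k
    have ih := connected_of_isAdmissible h k
    exact ih.succ h.length_eq (ih.isChain_link hE (h.fits e he))

theorem isChain_pattern [GrayFacts d] [StepFacts d] {D : List (SPerm d × Bool)}
    {R : Set (SPerm d × SPerm d)} (h : IsAdmissible D R) :
    ∀ k, (pattern D k).IsChain Link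
  | 0 => by simp [pattern]
  | k + 1 => by
    obtain ⟨e, he, hE⟩ := hasEnds_pattern h k
    exact (isChain_pattern_succ_iff h.length_eq).2
      ⟨fun q _ => isChain_place k q.1 q.2 (isChain_pattern h k),
        (connected_of_isAdmissible h k).isChain_link hE (h.fits e he)⟩

/-- The converse of `isChain_pattern`. -/
theorem fits_of_isChain_pattern [GrayFacts d] [StepFacts d] {D : List (SPerm d × Bool)}
    (hD : D.length = 2 ^ d) (h : ∀ k, (pattern D k).IsChain Link) {k : ℕ}
    {e : SPerm d × SPerm d} (he : HasEnds (pattern D k) e) : Fits D e := by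
  have hl : ∀ k, _ := fun k => ((isChain_pattern_succ_iff hD).1 (h (k + 1))).2
  have hc : ∀ k, Connected D k := fun k => by
    induction k with
    | zero => exact connected_zero D
    | succ k ih => exact ih.succ hD (hl k)
  exact (hc k).fits he (hl k)

theorem isIsometricImage_placeV (k : ℕ) (v : Vertex d) (γ : SPerm d × Bool)
    (C : List (Vertex d)) : IsIsometricImage C (placeV k v γ C) := by
  refine ⟨fun c => shift k v (act k γ.1 c), ⟨γ.1.perm, fun j => if γ.1.neg j then -1 else 1,
    fun j => 2 ^ k * v j + if γ.1.neg j then 2 ^ k - 1 else 0, fun v j => ?_⟩, ?_⟩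
  · simp only [shift, act]
    split <;> simp <;> ring
  · obtain ⟨g, r⟩ := γ
    cases r
    · exact Or.inl rfl
    · exact Or.inr rfl

/-! ### Admissible lists yield curves with the required properties -/

/-- The curves of `pattern D`. -/
def curves (D : List (SPerm d × Bool)) (k : ℕ) : List (Vertex d) := (pattern D k).map Prod.fst

theorem curves_zero (D : List (SPerm d × Bool)) : curves D 0 = [0] := rfl

theorem curves_succ [GrayFacts d] {D : List (SPerm d × Bool)} (hD : D.length = 2 ^ d) (k : ℕ) :
    curves D (k + 1) = inflate (pattern D k) := (inflate_pattern hD k).symm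

theorem isKCurve_curves [GrayFacts d] [StepFacts d] {D : List (SPerm d × Bool)}
    {R : Set (SPerm d × SPerm d)} (h : IsAdmissible D R) (k : ℕ) : IsKCurve k (curves D k) := by
  have hne : ∀ k, curves D k ≠ [] := fun k => by
    obtain ⟨e, _, he⟩ := hasEnds_pattern h k
    simpa [curves] using he.ne_nil
  have hnodup : ∀ k, (curves D k).Nodup := fun k => by
    induction k with
    | zero => simp [curves_zero]
    | succ k ih =>
      rw [curves_succ h.length_eq]
      exact nodup_inflate ih
  refine ⟨⟨hne k, hnodup k, ?_⟩, 0, ?_⟩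
  · cases k with
    | zero => simp [curves_zero]
    | succ k =>
      rw [curves_succ h.length_eq]
      exact isChain_inflate (isChain_pattern h k)
  · induction k with
    | zero =>
      intro v
      simp only [curves_zero, List.mem_singleton, funext_iff, Pi.zero_apply, pow_zero, zero_add]
      exact forall_congr' fun j => by omega
    | succ k ih =>
      intro v
      rw [curves_succ h.length_eq, mem_inflate]
      refine (ih _).trans (forall_congr' fun j => ?_)
      simp only [Pi.zero_apply, zero_add]
      rw [pow_succ]
      omega

theorem isInflation_curves [GrayFacts d] [StepFacts d] {D : List (SPerm d × Bool)}
    {R : Set (SPerm d × SPerm d)} (h : IsAdmissible D R) (k : ℕ) :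
    IsInflation (IsIsometricImage (grayCurve d)) (curves D k) (curves D (k + 1)) := by
  rw [curves_succ h.length_eq]
  exact isInflation_inflate (isChain_pattern h k)

theorem isApproximation_curves [GrayFacts d] [StepFacts d] {D : List (SPerm d × Bool)}
    {R : Set (SPerm d × SPerm d)} (h : IsAdmissible D R) : IsApproximation (curves D) := by
  refine ⟨rfl, isKCurve_curves h, fun k => ?_⟩
  obtain ⟨L, h1, h2, h3, h4⟩ := isInflation_curves h k
  exact ⟨L, h1, h2, fun p hp => ⟨(h3 p hp).1, (h3 p hp).2.1, trivial⟩, h4⟩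

theorem wellFolded_curves [GrayFacts d] [StepFacts d] {D : List (SPerm d × Bool)}
    {R : Set (SPerm d × SPerm d)} (h : IsAdmissible D R) : ∀ k, WellFolded (curves D k)
  | 0 => WellFolded.vertex 0
  | k + 1 => (wellFolded_curves h k).inflate (isInflation_curves h k)

theorem hyperorthogonal_curves [GrayFacts d] [StepFacts d] {D : List (SPerm d × Bool)}
    {R : Set (SPerm d × SPerm d)} (h : IsAdmissible D R) : ∀ k, Hyperorthogonal (curves D k)
  | 0 => fun n _ S hS hl => by
    have := hS.length_le
    have h2 : 0 < 2 ^ n := by positivity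
    simp only [curves_zero, List.length_singleton] at this
    omega
  | k + 1 => by
    rw [curves_succ h.length_eq]
    exact hyperorthogonal_inflate (isChain_pattern h k)

theorem curves_succ_eq_flatMap (D : List (SPerm d × Bool)) (k : ℕ) :
    curves D (k + 1) = ((grayCurve d).zip D).flatMap fun q => placeV k q.1 q.2 (curves D k) := by
  simp only [curves, pattern, List.map_flatMap, map_fst_place]

theorem selfSimilar_curves [GrayFacts d] {D : List (SPerm d × Bool)} (hD : D.length = 2 ^ d) :
    SelfSimilar (curves D) := fun k =>
  ⟨((grayCurve d).zip D).map fun q => placeV k q.1 q.2 (curves D k),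
    by simp [GrayFacts.length_eq, hD], by rw [curves_succ_eq_flatMap, List.flatMap_def],
    fun C hC => by
      obtain ⟨q, _, rfl⟩ := List.mem_map.1 hC
      exact isIsometricImage_placeV k q.1 q.2 _⟩

/-! ### The limit of a sequence of approximating curves -/

theorem le_of_forall_le_add_inv_two_pow {a b : ℝ} (h : ∀ m : ℕ, a ≤ b + 1 / 2 ^ m) : a ≤ b := by
  refine le_of_forall_pos_le_add fun ε hε => ?_
  obtain ⟨m, hm⟩ := exists_pow_lt_of_lt_one hε (by norm_num : (1 / 2 : ℝ) < 1)
  rw [one_div_pow] at hm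
  linarith [h m]

/-- The number of a time interval at level `k` that contains the time `t`. -/
noncomputable def timeIndex (d k : ℕ) (t : ℝ) : ℕ := min ⌊t * 2 ^ (d * k)⌋₊ (2 ^ (d * k) - 1)

theorem timeIndex_lt (d k : ℕ) (t : ℝ) : timeIndex d k t < 2 ^ (d * k) := by
  have : 0 < 2 ^ (d * k) := by positivity
  have := min_le_right ⌊t * 2 ^ (d * k)⌋₊ (2 ^ (d * k) - 1)
  rw [timeIndex]
  omega

/-- Both terms of the minimum are compatible with division; the second one assigns `t = 1` to the
last interval at each level. -/
theorem timeIndex_div (d k m : ℕ) (t : ℝ) :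
    timeIndex d (k + m) t / 2 ^ (d * m) = timeIndex d k t := by
  have hM : 0 < 2 ^ (d * m) := by positivity
  have hN : 0 < 2 ^ (d * k) := by positivity
  have h1 : ⌊t * 2 ^ (d * (k + m))⌋₊ / 2 ^ (d * m) = ⌊t * 2 ^ (d * k)⌋₊ := by
    rw [← Nat.floor_div_natCast]
    congr 1
    push_cast
    rw [mul_add, pow_add]
    field_simp
  have h2 : (2 ^ (d * (k + m)) - 1) / 2 ^ (d * m) = 2 ^ (d * k) - 1 := by
    rw [mul_add, pow_add]
    refine Nat.div_eq_of_lt_le ?_ ?_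
    · rw [Nat.sub_mul, one_mul]; omega
    · rw [Nat.sub_add_cancel hN]
      have := Nat.mul_pos hN hM
      omega
  rw [timeIndex, timeIndex, ← h1, ← h2]
  exact Monotone.map_min fun _ _ h => Nat.div_le_div_right h

/-- The vertices of a sequence of curves. -/
def vert (A : ℕ → List (Vertex d)) (k i : ℕ) : Vertex d := (A k).getD i 0

namespace IsApproximation

variable {A : ℕ → List (Vertex d)}

theorem getElem?_vert (h : IsApproximation A) {k i : ℕ} (hi : i < 2 ^ (d * k)) :
    (A k)[i]? = some (vert A k i) := by
  have : i < (A k).length := by rwa [h.length_eq]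
  simp [vert, this]

theorem vert_div (h : IsApproximation A) {k m i : ℕ} (hi : i < 2 ^ (d * (k + m))) (j : Fin d) :
    vert A k (i / 2 ^ (d * m)) j = vert A (k + m) i j / 2 ^ m := by
  have h1 := h.getElem?_div k m (h.getElem?_vert hi)
  have : i / 2 ^ (d * m) < 2 ^ (d * k) := by
    rw [Nat.div_lt_iff_lt_mul (by positivity), ← pow_add, ← mul_add]
    exact hi
  rw [h.getElem?_vert this, Option.some_inj] at h1
  rw [h1]

theorem two_pow_mul_vert_le (h : IsApproximation A) {k m i : ℕ} (hi : i < 2 ^ (d * (k + m)))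
    (j : Fin d) :
    (2 : ℝ) ^ m * vert A k (i / 2 ^ (d * m)) j ≤ vert A (k + m) i j ∧
      (vert A (k + m) i j : ℝ) + 1 ≤ 2 ^ m * (vert A k (i / 2 ^ (d * m)) j + 1) := by
  rw [h.vert_div hi]
  have hp : (0 : ℤ) < 2 ^ m := by positivity
  have h1 := Int.mul_ediv_self_le (x := vert A (k + m) i j) hp.ne'
  have h2 := Int.lt_mul_ediv_self_add (x := vert A (k + m) i j) hp
  constructor
  · exact_mod_cast h1
  · have : vert A (k + m) i j + 1 ≤ 2 ^ m * (vert A (k + m) i j / 2 ^ m + 1) := by linarith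
    exact_mod_cast this

theorem vert_succ (h : IsApproximation A) {k i : ℕ} (hi : i + 1 < 2 ^ (d * k)) (j : Fin d) :
    |(vert A k (i + 1) j : ℝ) - vert A k i j| ≤ 1 := by
  have hc := (h.kCurve k).1.2.2
  rw [List.isChain_iff_getElem] at hc
  have hl := h.length_eq k
  have he : ∑ j, (vert A k (i + 1) j - vert A k i j) ^ 2 = 1 := by
    have := hc i (by omega)
    rwa [IsEdge, ← List.getD_eq_getElem _ 0, ← List.getD_eq_getElem _ 0] at this
  have h1 : (vert A k (i + 1) j - vert A k i j) ^ 2 ≤ 1 := by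
    rw [← he]
    exact Finset.single_le_sum (f := fun j => (vert A k (i + 1) j - vert A k i j) ^ 2)
      (fun _ _ => sq_nonneg _) (Finset.mem_univ j)
  have h2 : |vert A k (i + 1) j - vert A k i j| ≤ 1 := by
    rwa [← sq_le_one_iff_abs_le_one]
  exact_mod_cast h2

end IsApproximation

/-- The point that the space-filling curve approximated by `A` visits at the time `t`. -/
noncomputable def limitPoint (A : ℕ → List (Vertex d)) (t : ℝ) (j : Fin d) : ℝ :=
  ⨆ k, (vert A k (timeIndex d k t) j : ℝ) / 2 ^ k

namespace IsApproximation

variable {A : ℕ → List (Vertex d)}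

theorem div_le_div_add (h : IsApproximation A) (k m : ℕ) (t : ℝ) (j : Fin d) :
    (vert A k (timeIndex d k t) j : ℝ) / 2 ^ k ≤
        (vert A (k + m) (timeIndex d (k + m) t) j : ℝ) / 2 ^ (k + m) ∧
      ((vert A (k + m) (timeIndex d (k + m) t) j : ℝ) + 1) / 2 ^ (k + m) ≤
        ((vert A k (timeIndex d k t) j : ℝ) + 1) / 2 ^ k := by
  have h1 := h.two_pow_mul_vert_le (timeIndex_lt d (k + m) t) j
  rw [timeIndex_div] at h1
  have hk : (0 : ℝ) < 2 ^ k := by positivity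
  have hm : (0 : ℝ) < 2 ^ m := by positivity
  rw [pow_add]
  constructor
  · rw [div_le_div_iff₀ hk (by positivity)]
    nlinarith [mul_le_mul_of_nonneg_left h1.1 hk.le]
  · rw [div_le_div_iff₀ (by positivity) hk]
    nlinarith [mul_le_mul_of_nonneg_left h1.2 hk.le]

/-- The cells at time `t` are nested, so every lower corner is below every upper corner and the
supremum of the lower corners lies in all cells. -/
theorem div_le_limitPoint (h : IsApproximation A) (k : ℕ) (t : ℝ) (j : Fin d) :
    (vert A k (timeIndex d k t) j : ℝ) / 2 ^ k ≤ limitPoint A t j ∧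
      limitPoint A t j ≤ ((vert A k (timeIndex d k t) j : ℝ) + 1) / 2 ^ k := by
  have key : ∀ n, (vert A n (timeIndex d n t) j : ℝ) / 2 ^ n ≤
      ((vert A k (timeIndex d k t) j : ℝ) + 1) / 2 ^ k := fun n => by
    rcases le_total k n with hn | hn
    · obtain ⟨m, rfl⟩ := Nat.exists_eq_add_of_le hn
      refine le_trans ?_ (h.div_le_div_add k m t j).2
      gcongr
      linarith
    · obtain ⟨m, rfl⟩ := Nat.exists_eq_add_of_le hn
      refine (h.div_le_div_add n m t j).1.trans ?_
      gcongr
      linarith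
  have hb : BddAbove (Set.range fun k => (vert A k (timeIndex d k t) j : ℝ) / 2 ^ k) :=
    ⟨_, by rintro _ ⟨n, rfl⟩; exact key n⟩
  exact ⟨le_ciSup hb k, ciSup_le key⟩

theorem timeIndex_eq {k i : ℕ} (hi : i < 2 ^ (d * k)) {t : ℝ}
    (h1 : (i : ℝ) / 2 ^ (d * k) ≤ t) (h2 : t < ((i : ℝ) + 1) / 2 ^ (d * k)) :
    timeIndex d k t = i := by
  have hp : (0 : ℝ) < 2 ^ (d * k) := by positivity
  rw [div_le_iff₀ hp] at h1
  rw [lt_div_iff₀ hp] at h2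
  have : ⌊t * 2 ^ (d * k)⌋₊ = i :=
    (Nat.floor_eq_iff (le_trans (Nat.cast_nonneg i) h1)).2 ⟨h1, h2⟩
  rw [timeIndex, this]
  omega

/-- The limit curve is in the cells represented by `A k` also at the ends of time intervals. -/
theorem limitPoint_mem (h : IsApproximation A) {k i : ℕ} (hi : i < 2 ^ (d * k)) {t : ℝ}
    (h1 : (i : ℝ) / 2 ^ (d * k) ≤ t) (h2 : t ≤ ((i : ℝ) + 1) / 2 ^ (d * k)) (j : Fin d) :
    (vert A k i j : ℝ) / 2 ^ k ≤ limitPoint A t j ∧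
      limitPoint A t j ≤ ((vert A k i j : ℝ) + 1) / 2 ^ k := by
  rcases h2.lt_or_eq with h2 | h2
  · have := h.div_le_limitPoint k t j
    rwa [timeIndex_eq hi h1 h2] at this
  rcases Nat.lt_or_ge (i + 1) (2 ^ (d * k)) with hi' | hi'
  -- Here `t` starts interval `i + 1`. At level `k + m` the last vertex `n` below vertex `i` and its
  -- successor `n + 1`, visited at time `t`, are neighbours, so the limit point is within `2 ^ -(k +
  -- m)` of the cell in each coordinate.
  · have key : ∀ m : ℕ, (vert A k i j : ℝ) / 2 ^ k ≤ limitPoint A t j + 1 / 2 ^ m ∧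
        limitPoint A t j ≤ ((vert A k i j : ℝ) + 1) / 2 ^ k + 1 / 2 ^ m := fun m => by
      have hM : 0 < 2 ^ (d * m) := by positivity
      obtain ⟨n, hn⟩ : ∃ n, (i + 1) * 2 ^ (d * m) = n + 1 :=
        ⟨(i + 1) * 2 ^ (d * m) - 1, by
          have : 0 < (i + 1) * 2 ^ (d * m) := by positivity
          omega⟩
      have hlt : n + 1 < 2 ^ (d * (k + m)) := by
        rw [← hn, mul_add, pow_add]
        exact Nat.mul_lt_mul_of_pos_right hi' hM
      have hdiv : n / 2 ^ (d * m) = i := by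
        refine Nat.div_eq_of_lt_le ?_ ?_
        · rw [add_mul, one_mul] at hn; omega
        · rw [hn]; omega
      have ht : timeIndex d (k + m) t = n + 1 := by
        have hnr : ((n + 1 : ℕ) : ℝ) = (i + 1) * 2 ^ (d * m) := by rw [← hn]; push_cast; ring
        have hp : (0 : ℝ) < 2 ^ (d * m) := by positivity
        have htt : t = ((n + 1 : ℕ) : ℝ) / 2 ^ (d * (k + m)) := by
          rw [h2, hnr, mul_add, pow_add]
          field_simp
        refine timeIndex_eq hlt htt.ge ?_
        rw [htt]
        gcongr
        linarith
      have a := h.div_le_limitPoint (k + m) t j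
      have b := h.two_pow_mul_vert_le (Nat.lt_of_succ_lt hlt) j
      have c := abs_le.1 (h.vert_succ hlt j)
      rw [ht] at a
      rw [hdiv] at b
      have hk : (0 : ℝ) < 2 ^ k := by positivity
      have hk1 : (1 : ℝ) ≤ 2 ^ k := one_le_pow₀ (by norm_num)
      have hm : (0 : ℝ) < 2 ^ m := by positivity
      have hinv : (1 : ℝ) / 2 ^ (k + m) ≤ 1 / 2 ^ m := by
        rw [pow_add]
        exact one_div_le_one_div_of_le hm (by nlinarith)
      have e1 : (vert A k i j : ℝ) / 2 ^ k = 2 ^ m * vert A k i j / 2 ^ (k + m) := by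
        rw [pow_add]; field_simp
      have e2 : ((vert A k i j : ℝ) + 1) / 2 ^ k = 2 ^ m * (vert A k i j + 1) / 2 ^ (k + m) := by
        rw [pow_add]; field_simp
      constructor
      · have : (2 : ℝ) ^ m * vert A k i j / 2 ^ (k + m) ≤
            (vert A (k + m) (n + 1) j + 1) / 2 ^ (k + m) := by
          gcongr
          linarith [b.1, c.1]
        rw [add_div] at this
        linarith [a.1]
      · have : ((vert A (k + m) (n + 1) j : ℝ) + 1) / 2 ^ (k + m) ≤
            (2 ^ m * (vert A k i j + 1) + 1) / 2 ^ (k + m) := by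
          gcongr
          linarith [b.2, c.2]
        rw [add_div (2 ^ m * _)] at this
        linarith [a.2]
    exact ⟨le_of_forall_le_add_inv_two_pow fun m => (key m).1,
      le_of_forall_le_add_inv_two_pow fun m => (key m).2⟩
  -- Here `t = 1`, which the minimum in `timeIndex` assigns to the last interval.
  · have hi0 : 2 ^ (d * k) = i + 1 := by omega
    have hp : (2 : ℝ) ^ (d * k) = i + 1 := by exact_mod_cast hi0
    have ht : timeIndex d k t = i := by
      have : t * 2 ^ (d * k) = ((i + 1 : ℕ) : ℝ) := by
        rw [h2, div_mul_cancel₀ _ (by positivity)]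
        push_cast; rfl
      rw [timeIndex, this, Nat.floor_natCast]
      omega
    have := h.div_le_limitPoint k t j
    rwa [ht] at this

theorem timeIndex_mem (k : ℕ) {t : ℝ} (h0 : 0 ≤ t) (h1 : t ≤ 1) :
    (timeIndex d k t : ℝ) / 2 ^ (d * k) ≤ t ∧
      t ≤ ((timeIndex d k t : ℝ) + 1) / 2 ^ (d * k) := by
  have hp : (0 : ℝ) < 2 ^ (d * k) := by positivity
  have hp' : 0 < 2 ^ (d * k) := by positivity
  have h0' : 0 ≤ t * 2 ^ (d * k) := by positivity
  rw [div_le_iff₀ hp, le_div_iff₀ hp]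
  constructor
  · refine le_trans ?_ (Nat.floor_le h0')
    exact Nat.cast_le.2 (min_le_left _ _)
  · rcases min_choice ⌊t * 2 ^ (d * k)⌋₊ (2 ^ (d * k) - 1) with hm | hm
    · rw [timeIndex, hm]
      exact (Nat.lt_floor_add_one _).le
    · rw [timeIndex, hm]
      have : ((2 ^ (d * k) - 1 : ℕ) : ℝ) + 1 = 2 ^ (d * k) := by
        have : (2 ^ (d * k) - 1) + 1 = 2 ^ (d * k) := by omega
        exact_mod_cast this
      rw [this]
      nlinarith

theorem abs_vert_sub_le (h : IsApproximation A) (k : ℕ) {i i' : ℕ} (hi : i < 2 ^ (d * k))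
    (hi' : i' < 2 ^ (d * k)) (h1 : i ≤ i' + 1) (h2 : i' ≤ i + 1) (j : Fin d) :
    |(vert A k i j : ℝ) - vert A k i' j| ≤ 1 := by
  rcases Nat.lt_trichotomy i i' with h3 | h3 | h3
  · obtain rfl : i' = i + 1 := by omega
    rw [abs_sub_comm]
    exact h.vert_succ hi' j
  · simp [h3]
  · obtain rfl : i = i' + 1 := by omega
    exact h.vert_succ hi j

theorem timeIndex_le_succ (k : ℕ) {s t : ℝ} (ht : 0 ≤ t) (hst : s - t < 1 / 2 ^ (d * k)) :
    timeIndex d k s ≤ timeIndex d k t + 1 := by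
  have hp : (0 : ℝ) < 2 ^ (d * k) := by positivity
  have : ⌊s * 2 ^ (d * k)⌋₊ ≤ ⌊t * 2 ^ (d * k)⌋₊ + 1 := by
    rw [← Nat.floor_add_one (by positivity)]
    refine Nat.floor_le_floor ?_
    rw [lt_div_iff₀ hp] at hst
    linarith
  simp only [timeIndex]
  omega

/-- Times closer than one interval have equal or consecutive indices, and consecutive vertices
differ by at most 1 in each coordinate. -/
theorem abs_limitPoint_sub_le (h : IsApproximation A) (k : ℕ) {s t : ℝ} (hs : 0 ≤ s) (ht : 0 ≤ t)
    (hst : |s - t| < 1 / 2 ^ (d * k)) (j : Fin d) :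
    |limitPoint A s j - limitPoint A t j| ≤ 2 / 2 ^ k := by
  rw [abs_lt] at hst
  have h1 := timeIndex_le_succ (d := d) k ht hst.2
  have h2 := timeIndex_le_succ (d := d) k hs (s := t) (by linarith [hst.1])
  have h3 := abs_le.1 (h.abs_vert_sub_le k (timeIndex_lt d k s) (timeIndex_lt d k t) h1 h2 j)
  have a := h.div_le_limitPoint k s j
  have b := h.div_le_limitPoint k t j
  have hk : (0 : ℝ) < 2 ^ k := by positivity
  rw [div_le_iff₀ hk, le_div_iff₀ hk] at a b
  rw [abs_le, ← neg_div, div_le_iff₀ hk, le_div_iff₀ hk]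
  constructor <;> nlinarith

theorem continuous_limitPoint (h : IsApproximation A) :
    Continuous fun t : unitInterval => limitPoint A (t : ℝ) := by
  refine continuous_pi fun j => Metric.continuous_iff.2 fun t ε hε => ?_
  obtain ⟨k, hk⟩ := exists_pow_lt_of_lt_one (half_pos hε) (by norm_num : (1 / 2 : ℝ) < 1)
  rw [one_div_pow] at hk
  refine ⟨1 / 2 ^ (d * k), by positivity, fun s hs => ?_⟩
  have h1 := h.abs_limitPoint_sub_le k s.2.1 t.2.1 hs j
  rw [Real.dist_eq]
  have : (2 : ℝ) / 2 ^ k = 2 * (1 / 2 ^ k) := by ring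
  linarith

/-- The limit curve visits all points of a cell during the corresponding time interval. -/
theorem exists_limitPoint_eq (h : IsApproximation A) {k i : ℕ} (hi : i < 2 ^ (d * k))
    {x : Fin d → ℝ}
    (hx : ∀ j, (vert A k i j : ℝ) / 2 ^ k ≤ x j ∧ x j ≤ ((vert A k i j : ℝ) + 1) / 2 ^ k) :
    ∃ t : unitInterval, ((i : ℝ) / 2 ^ (d * k) ≤ t ∧ (t : ℝ) ≤ ((i : ℝ) + 1) / 2 ^ (d * k)) ∧
      limitPoint A (t : ℝ) = x := by
  set I : Set unitInterval :=
    {t | (i : ℝ) / 2 ^ (d * k) ≤ t ∧ (t : ℝ) ≤ ((i : ℝ) + 1) / 2 ^ (d * k)} with hI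
  have hIc : IsClosed I :=
    (isClosed_le continuous_const continuous_subtype_val).inter
      (isClosed_le continuous_subtype_val continuous_const)
  -- By compactness of the image it is enough to approximate `x`, by points visited at the starts of
  -- finer intervals.
  have hc : IsClosed ((fun t : unitInterval => limitPoint A (t : ℝ)) '' I) :=
    (hIc.isCompact.image h.continuous_limitPoint).isClosed
  have hmem : x ∈ closure ((fun t : unitInterval => limitPoint A (t : ℝ)) '' I) := by
    rw [Metric.mem_closure_iff]
    intro ε hε
    obtain ⟨m, hm⟩ := exists_pow_lt_of_lt_one hε (by norm_num : (1 / 2 : ℝ) < 1)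
    rw [one_div_pow] at hm
    have hk : (0 : ℝ) < 2 ^ k := by positivity
    have hk1 : (1 : ℝ) ≤ 2 ^ k := one_le_pow₀ (by norm_num)
    have hmp : (0 : ℝ) < 2 ^ m := by positivity
    have hmz : (0 : ℤ) < 2 ^ m := by positivity
    -- The cell of `w` at level `k + m` contains `x`; the minimum keeps `w` below vertex `i` of
    -- level `k` if `x` is on an upper face.
    set w : Vertex d := fun j =>
      min ⌊x j * 2 ^ (k + m)⌋ (2 ^ m * vert A k i j + 2 ^ m - 1) with hw
    have hx' : ∀ j, ((2 ^ m * vert A k i j : ℤ) : ℝ) ≤ x j * 2 ^ (k + m) ∧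
        x j * 2 ^ (k + m) ≤ ((2 ^ m * vert A k i j + 2 ^ m : ℤ) : ℝ) := fun j => by
      have := hx j
      rw [div_le_iff₀ hk, le_div_iff₀ hk] at this
      push_cast
      rw [pow_add]
      constructor <;> nlinarith
    have hw1 : ∀ j, 2 ^ m * vert A k i j ≤ w j := fun j =>
      le_min (Int.le_floor.2 (hx' j).1) (by linarith)
    have hw2 : ∀ j, w j < 2 ^ m * (vert A k i j + 1) := fun j => by
      have := min_le_right ⌊x j * 2 ^ (k + m)⌋ (2 ^ m * vert A k i j + 2 ^ m - 1)
      rw [hw]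
      linarith
    have hwx : ∀ j, (w j : ℝ) ≤ x j * 2 ^ (k + m) ∧ x j * 2 ^ (k + m) ≤ w j + 1 := fun j => by
      constructor
      · refine le_trans ?_ (Int.floor_le _)
        exact Int.cast_le.2 (min_le_left _ _)
      · rcases min_choice ⌊x j * 2 ^ (k + m)⌋ (2 ^ m * vert A k i j + 2 ^ m - 1) with hc | hc
        · simp only [hw, hc]
          exact (Int.lt_floor_add_one _).le
        · simp only [hw, hc]
          have := (hx' j).2
          push_cast at this ⊢
          linarith
    have hdiv : ∀ j, w j / 2 ^ m = vert A k i j := fun j =>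
      (Int.ediv_eq_iff_of_pos hmz).2 ⟨by linarith [hw1 j], by linarith [hw2 j]⟩
    have hv := (h.mem_iff k _).1 (List.mem_of_getElem? (h.getElem?_vert hi))
    have hwA : w ∈ A (k + m) := by
      refine (h.mem_iff (k + m) w).2 fun j => ⟨?_, ?_⟩
      · exact (mul_nonneg hmz.le (hv j).1).trans (hw1 j)
      · refine (hw2 j).trans_le ?_
        rw [pow_add, mul_comm (2 ^ k)]
        exact mul_le_mul_of_nonneg_left (hv j).2 hmz.le
    obtain ⟨n, hn⟩ := List.getElem?_of_mem hwA
    have hnlt : n < 2 ^ (d * (k + m)) := by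
      rw [← h.length_eq]
      exact (List.getElem?_eq_some_iff.1 hn).1
    have hvw : vert A (k + m) n = w := by
      have := h.getElem?_vert hnlt
      rw [hn, Option.some_inj] at this
      exact this.symm
    -- Positions `i` and `n / 2 ^ (d * m)` of `A k` carry the same vertex, and the vertices are
    -- distinct.
    have hni : n / 2 ^ (d * m) = i := by
      have h1 := h.getElem?_div k m hn
      simp only [hdiv] at h1
      have h2 := h.getElem?_vert hi
      exact (List.getElem?_inj (by rwa [h.length_eq]) (h.kCurve k).1.2.1).1
        (h2.trans h1.symm) |>.symm
    have hP : (0 : ℝ) < 2 ^ (d * (k + m)) := by positivity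
    have hPk : (0 : ℝ) < 2 ^ (d * k) := by positivity
    have hPm : (0 : ℝ) < 2 ^ (d * m) := by positivity
    have hPe : (2 : ℝ) ^ (d * (k + m)) = 2 ^ (d * k) * 2 ^ (d * m) := by rw [mul_add, pow_add]
    have hn1 : (i : ℝ) * 2 ^ (d * m) ≤ n := by
      rw [← hni]; exact_mod_cast Nat.div_mul_le_self n _
    have hn2 : (n : ℝ) ≤ (i + 1) * 2 ^ (d * m) := by
      have : n ≤ (i + 1) * 2 ^ (d * m) := by
        rw [← hni, mul_comm]; exact (Nat.lt_mul_div_succ n (by positivity)).le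
      exact_mod_cast this
    have ht1 : (n : ℝ) / 2 ^ (d * (k + m)) ≤ 1 := by
      rw [div_le_one hP]
      exact_mod_cast hnlt.le
    refine ⟨_, ⟨⟨(n : ℝ) / 2 ^ (d * (k + m)), by positivity, ht1⟩, ⟨?_, ?_⟩, rfl⟩, ?_⟩
    · simp only
      rw [div_le_div_iff₀ hPk hP, hPe]
      nlinarith
    · simp only
      rw [div_le_div_iff₀ hP hPk, hPe]
      nlinarith
    · rw [dist_comm]
      refine lt_of_le_of_lt ((dist_pi_le_iff (by positivity : (0 : ℝ) ≤ 1 / 2 ^ m)).2 ?_) hm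
      intro j
      have a := h.limitPoint_mem hnlt le_rfl
        (t := (n : ℝ) / 2 ^ (d * (k + m))) (by gcongr; linarith) j
      rw [hvw] at a
      have b := hwx j
      have hQ : (0 : ℝ) < 2 ^ (k + m) := by positivity
      have hinv : (1 : ℝ) / 2 ^ (k + m) ≤ 1 / 2 ^ m := by
        rw [pow_add]
        exact one_div_le_one_div_of_le hmp (by nlinarith)
      refine le_trans ?_ hinv
      rw [← div_le_iff₀ hQ, ← le_div_iff₀ hQ, add_div] at b
      rw [add_div] at a
      rw [Real.dist_eq, abs_le]
      constructor <;> linarith [a.1, a.2, b.1, b.2]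
  rw [hc.closure_eq] at hmem
  obtain ⟨t, ht, rfl⟩ := hmem
  exact ⟨t, ht, rfl⟩

/-- Every sequence of approximating curves has a limit. -/
theorem exists_approximates (h : IsApproximation A) :
    ∃ f : unitInterval → EuclideanSpace ℝ (Fin d), IsSpaceFilling f ∧ Approximates A f := by
  set f : unitInterval → EuclideanSpace ℝ (Fin d) :=
    fun t => WithLp.toLp 2 (limitPoint A (t : ℝ)) with hf
  have himage : ∀ (k i : ℕ) (hi : i < (A k).length),
      f '' {t | (i : ℝ) / 2 ^ (d * k) ≤ (t : ℝ) ∧ (t : ℝ) ≤ ((i : ℝ) + 1) / 2 ^ (d * k)} =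
        cell k (A k)[i] := by
    intro k i hi
    have hi' : i < 2 ^ (d * k) := by rwa [← h.length_eq]
    have hv : (A k)[i] = vert A k i := by simp [vert, hi]
    rw [hv]
    ext x
    constructor
    · rintro ⟨t, ht, rfl⟩ j
      exact h.limitPoint_mem hi' ht.1 ht.2 j
    · intro hx
      obtain ⟨t, ht, hx⟩ := h.exists_limitPoint_eq hi' (x := x.ofLp) hx
      refine ⟨t, ht, ?_⟩
      simp [hf, hx]
  refine ⟨f, ⟨(PiLp.continuous_toLp 2 _).comp h.continuous_limitPoint, ?_⟩,
    h.zero, h.kCurve, h.inflation, himage⟩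
  -- At level 0 the only cell is the unit cube and the only interval is `[0,1]`; this is
  -- surjectivity.
  have h0 := himage 0 0 (by simp [h.zero])
  have : {t : unitInterval | ((0 : ℕ) : ℝ) / 2 ^ (d * 0) ≤ (t : ℝ) ∧
      (t : ℝ) ≤ (((0 : ℕ) : ℝ) + 1) / 2 ^ (d * 0)} = Set.univ := by
    ext t
    simp [t.2.1, t.2.2]
  rw [this, Set.image_univ] at h0
  rw [h0]
  have hz : (A 0)[0]'(by simp [h.zero]) = 0 := by simp [h.zero]
  rw [hz]
  ext x
  simp [cell, unitCube]

end IsApproximation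

/-! ### Isometric approximations and isometric limits -/

theorem SameUpToIsometry.symm {f g : unitInterval → EuclideanSpace ℝ (Fin d)}
    (h : SameUpToIsometry f g) : SameUpToIsometry g f := by
  obtain ⟨φ, h | h⟩ := h
  · exact ⟨φ.symm, Or.inl fun t => by simp [h]⟩
  · exact ⟨φ.symm, Or.inr fun t => by simp [h]⟩

/-- The action of signed permutations on the unit cube. -/
def realAct (g : SPerm d) (x : EuclideanSpace ℝ (Fin d)) : EuclideanSpace ℝ (Fin d) :=
  WithLp.toLp 2 fun j => if g.neg j then 1 - x (g.perm j) else x (g.perm j)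

theorem realAct_apply (g : SPerm d) (x : EuclideanSpace ℝ (Fin d)) (j : Fin d) :
    realAct g x j = if g.neg j then 1 - x (g.perm j) else x (g.perm j) := rfl

theorem realAct_mul (g h : SPerm d) (x : EuclideanSpace ℝ (Fin d)) :
    realAct (g * h) x = realAct g (realAct h x) := by
  ext j
  simp only [realAct_apply, SPerm.mul_neg, SPerm.mul_perm, Equiv.Perm.mul_apply]
  by_cases hg : g.neg j = true <;> by_cases hh : h.neg (g.perm j) = true <;> simp [hg, hh]

theorem realAct_one (x : EuclideanSpace ℝ (Fin d)) : realAct 1 x = x := by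
  ext j
  simp [realAct_apply]

theorem isometry_realAct (g : SPerm d) : Isometry (realAct g) := by
  refine Isometry.of_dist_eq fun x y => ?_
  rw [EuclideanSpace.dist_eq, EuclideanSpace.dist_eq,
    ← Equiv.sum_comp g.perm fun i => dist (x i) (y i) ^ 2]
  congr 1
  refine Finset.sum_congr rfl fun j _ => ?_
  simp only [realAct_apply]
  split
  · rw [dist_sub_left]
  · rfl

/-- The action of a signed permutation on the unit cube, as an isometry. -/
def realActEquiv (g : SPerm d) : EuclideanSpace ℝ (Fin d) ≃ᵢ EuclideanSpace ℝ (Fin d) where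
  toFun := realAct g
  invFun := realAct g⁻¹
  left_inv x := by rw [← realAct_mul, inv_mul_cancel, realAct_one]
  right_inv x := by rw [← realAct_mul, mul_inv_cancel, realAct_one]
  isometry_toFun := isometry_realAct g

theorem realAct_mem_cell {k : ℕ} {v : Vertex d} {x : EuclideanSpace ℝ (Fin d)}
    (hx : x ∈ cell k v) (g : SPerm d) : realAct g x ∈ cell k (act k g v) := by
  intro j
  have h := hx (g.perm j)
  have hk : (0 : ℝ) < 2 ^ k := by positivity
  rw [div_le_iff₀ hk, le_div_iff₀ hk] at h ⊢
  simp only [realAct_apply, act]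
  split
  · push_cast
    constructor <;> nlinarith
  · exact h

theorem eq_of_forall_mem_cell {x y : EuclideanSpace ℝ (Fin d)}
    (h : ∀ k, ∃ v : Vertex d, x ∈ cell k v ∧ y ∈ cell k v) : x = y := by
  have key : ∀ {x y : EuclideanSpace ℝ (Fin d)},
      (∀ k, ∃ v : Vertex d, x ∈ cell k v ∧ y ∈ cell k v) → ∀ j, x j ≤ y j := by
    intro x y h j
    refine le_of_forall_le_add_inv_two_pow fun k => ?_
    obtain ⟨v, hx, hy⟩ := h k
    have h1 := (hx j).2
    have h2 := (hy j).1
    rw [add_div] at h1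
    linarith
  ext j
  exact le_antisymm (key h j) (key (fun k => (h k).imp fun v hv => hv.symm) j)

theorem Approximates.mem_cell {A : ℕ → List (Vertex d)}
    {f : unitInterval → EuclideanSpace ℝ (Fin d)} (h : Approximates A f) {k i : ℕ}
    (hi : i < (A k).length) {t : unitInterval} (h1 : (i : ℝ) / 2 ^ (d * k) ≤ t)
    (h2 : (t : ℝ) ≤ ((i : ℝ) + 1) / 2 ^ (d * k)) : f t ∈ cell k (A k)[i] := by
  rw [← h.image_eq k i hi]
  exact ⟨t, ⟨h1, h2⟩, rfl⟩

/-- At each level `g t` and the image of `f t`, or of `f (1 - t)`, share a cell, and cells shrink to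
points. Reversal exchanges position `i` with `2 ^ (d * k) - 1 - i`. -/
theorem Approximates.sameUpToIsometry {A B : ℕ → List (Vertex d)}
    {f g : unitInterval → EuclideanSpace ℝ (Fin d)} (hf : Approximates A f)
    (hg : Approximates B g) (δ : SPerm d × Bool) (h : ∀ k, B k = placeV k 0 δ (A k)) :
    SameUpToIsometry f g := by
  obtain ⟨s, r⟩ := δ
  refine ⟨realActEquiv s, ?_⟩
  have hA := hf.isApproximation
  have hB := hg.isApproximation
  cases r
  · refine Or.inl fun t => eq_of_forall_mem_cell fun k => ?_
    obtain ⟨h1, h2⟩ := IsApproximation.timeIndex_mem (d := d) k t.2.1 t.2.2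
    have hi := timeIndex_lt d k t
    have hiA : timeIndex d k t < (A k).length := by rwa [hA.length_eq]
    have hiB : timeIndex d k t < (B k).length := by rwa [hB.length_eq]
    refine ⟨_, hg.mem_cell hiB h1 h2, ?_⟩
    have : (B k)[timeIndex d k t] = act k s (A k)[timeIndex d k t] := by
      simp [h k, placeV]
    rw [this]
    exact realAct_mem_cell (hf.mem_cell hiA h1 h2) s
  · refine Or.inr fun t => eq_of_forall_mem_cell fun k => ?_
    obtain ⟨h1, h2⟩ := IsApproximation.timeIndex_mem (d := d) k t.2.1 t.2.2
    have hi := timeIndex_lt d k t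
    have hiB : timeIndex d k t < (B k).length := by rwa [hB.length_eq]
    have hiA : 2 ^ (d * k) - 1 - timeIndex d k t < (A k).length := by
      rw [hA.length_eq]; omega
    refine ⟨_, hg.mem_cell hiB h1 h2, ?_⟩
    have : (B k)[timeIndex d k t] = act k s (A k)[2 ^ (d * k) - 1 - timeIndex d k t] := by
      simp [h k, placeV, hA.length_eq]
    rw [this]
    refine realAct_mem_cell (hf.mem_cell hiA ?_ ?_) s
    all_goals
      have hp : (0 : ℝ) < 2 ^ (d * k) := by positivity
      have hc : ((2 ^ (d * k) - 1 - timeIndex d k t : ℕ) : ℝ) =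
          2 ^ (d * k) - 1 - (timeIndex d k t : ℝ) := by
        rw [Nat.sub_sub, Nat.cast_sub (by omega)]
        push_cast
        ring
      rw [hc, unitInterval.coe_symm_eq]
      rw [div_le_iff₀ hp] at *
      rw [le_div_iff₀ hp] at *
      nlinarith

/-! ### From a space-filling curve to a list of images -/

theorem IsGridIsometry.exists_act {φ : Vertex d → Vertex d} (h : IsGridIsometry φ) {k : ℕ}
    {v : Vertex d} (hφ : ∀ x : Vertex d, (∀ j, 0 ≤ x j ∧ x j < 2 ^ k) →
      ∀ j, 2 ^ k * v j ≤ φ x j ∧ φ x j < 2 ^ k * v j + 2 ^ k) :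
    ∃ g : SPerm d, ∀ x, φ x = shift k v (act k g x) := by
  obtain ⟨π, s, t, h⟩ := h
  refine ⟨⟨π, fun j => decide (s j = -1)⟩, fun x => funext fun j => ?_⟩
  have hp : (0 : ℤ) < 2 ^ k := by positivity
  -- The images of two opposite corners of the cube leave only one possible translation.
  have h0 := hφ (fun _ => 0) (fun _ => ⟨le_rfl, hp⟩) j
  have h1 := hφ (fun _ => 2 ^ k - 1) (fun _ => ⟨by omega, by omega⟩) j
  rw [h] at h0 h1 ⊢
  simp only [shift, act]
  rcases Int.units_eq_one_or (s j) with hs | hs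
  · simp only [hs, Units.val_one, one_mul, zero_add, mul_zero] at h0 h1 ⊢
    have : decide ((1 : ℤˣ) = -1) = false := by decide
    simp only [this, Bool.false_eq_true, if_false]
    linarith
  · simp only [hs, Units.val_neg, Units.val_one, neg_mul, one_mul, zero_add, mul_zero,
      decide_true, if_true] at h0 h1 ⊢
    linarith

theorem IsIsometricImage.exists_placeV {C C' : List (Vertex d)} (h : IsIsometricImage C C')
    {k : ℕ} {v : Vertex d} (hC : ∀ x : Vertex d, (∀ j, 0 ≤ x j ∧ x j < 2 ^ k) → x ∈ C)
    (hC' : ∀ x ∈ C', ∀ j, 2 ^ k * v j ≤ x j ∧ x j < 2 ^ k * v j + 2 ^ k) :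
    ∃ γ, C' = placeV k v γ C := by
  obtain ⟨φ, hφ, h⟩ := h
  have hm : ∀ x ∈ C, φ x ∈ C' := by
    rcases h with rfl | rfl <;> intro x hx
    · exact List.mem_map_of_mem hx
    · exact List.mem_reverse.2 (List.mem_map_of_mem hx)
  obtain ⟨g, hg⟩ := hφ.exists_act (k := k) (v := v) fun x hx => hC' _ (hm x (hC x hx))
  have hg' : φ = fun x => shift k v (act k g x) := funext hg
  rcases h with rfl | rfl
  · exact ⟨(g, false), by simp [placeV, hg']⟩
  · exact ⟨(g, true), by simp [placeV, hg']⟩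

theorem exists_block [GrayFacts d] {v : Vertex d} {C : List (Vertex d)}
    (h : IsIsometricImage (grayCurve d) C)
    (hC : ∀ w, w ∈ C ↔ ∀ j, w j = 2 * v j ∨ w j = 2 * v j + 1) : ∃ s, C = block (v, s) := by
  obtain ⟨⟨g, r⟩, rfl⟩ := h.exists_placeV (k := 1) (v := v)
    (fun x hx => mem_grayCurve.2 fun j => by have := hx j; omega)
    (fun x hx j => by have := (hC x).1 hx j; omega)
  cases r
  · exact ⟨g, rfl⟩
  · refine ⟨g * SPerm.flip d, ?_⟩
    rw [block_flip]
    rfl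

/-- Halving every `2 ^ d`-th vertex recovers the parent. This identifies the unnamed parent in
`WellFolded` with the preceding approximating curve. -/
theorem IsInflation.unique {ok ok' : List (Vertex d) → Prop} {P P' Q : List (Vertex d)}
    (h : IsInflation ok P Q) (h' : IsInflation ok' P' Q) : P = P' := by
  have hl := h.length_eq
  have hp : 0 < 2 ^ d := by positivity
  have hPP : P.length = P'.length :=
    Nat.eq_of_mul_eq_mul_left hp (hl.symm.trans h'.length_eq)
  refine List.ext_getElem? fun i => ?_
  rcases Nat.lt_or_ge i P.length with hi | hi
  · have hi' : i * 2 ^ d < Q.length := by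
      rw [hl, mul_comm]
      exact Nat.mul_lt_mul_of_pos_left hi hp
    have h1 := h.getElem?_half (List.getElem?_eq_getElem hi')
    have h2 := h'.getElem?_half (List.getElem?_eq_getElem hi')
    rw [Nat.mul_div_cancel _ hp] at h1 h2
    rw [h1, h2]
  · rw [List.getElem?_eq_none hi, List.getElem?_eq_none (hPP ▸ hi)]

theorem WellFolded.exists_isInflation {Q : List (Vertex d)} (h : WellFolded Q)
    (hQ : Q.length ≠ 1) : ∃ P, IsInflation (IsIsometricImage (grayCurve d)) P Q := by
  cases h with
  | vertex v => simp at hQ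
  | inflate _ h => exact ⟨_, h⟩

/-- A well-folded hyperorthogonal inflation is given by states of the child curves. -/
theorem exists_states [GrayFacts d] [StepFacts d] {P Q : List (Vertex d)}
    (h : IsInflation (IsIsometricImage (grayCurve d)) P Q) (hP : P.IsChain IsEdge)
    (hQ : Hyperorthogonal Q) :
    ∃ S : List (Vertex d × SPerm d), S.map Prod.fst = P ∧ inflate S = Q ∧ S.IsChain Link := by
  obtain ⟨L, rfl, rfl, hL, hc⟩ := h
  have hs : ∀ p : Vertex d × List (Vertex d), ∃ s : SPerm d, p ∈ L → p.2 = block (p.1, s) := by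
    intro p
    by_cases hp : p ∈ L
    · obtain ⟨s, hs⟩ := exists_block (hL p hp).2.2 (hL p hp).2.1
      exact ⟨s, fun _ => hs⟩
    · exact ⟨1, fun h => absurd h hp⟩
  choose s hs using hs
  refine ⟨L.map fun p => (p.1, s p), by simp [Function.comp_def], ?_, ?_⟩
  · rw [inflate, List.flatMap_map]
    exact List.flatMap_congr fun p hp => (hs p hp).symm
  · rw [List.isChain_map] at hP ⊢
    refine List.isChain_iff_forall_rel_of_append_cons_cons.2 fun {p q} l₁ l₂ hl => ?_
    have hE := List.isChain_iff_forall_rel_of_append_cons_cons.1 hP hl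
    have hj := List.isChain_iff_forall_rel_of_append_cons_cons.1 hc hl
    have hp := hs p (by simp [hl])
    have hq := hs q (by simp [hl])
    rw [hp, hq, block_getLast?, block_head?] at hj
    have hj := hj _ rfl _ rfl
    refine (link_iff _ _ ?_).2 ⟨hE, ?_⟩
    · funext j
      have := congrFun hj j
      simp only [shift, Pi.sub_apply] at this ⊢
      linarith
    · refine hQ.of_infix ?_
      rw [← hp, ← hq, hl]
      exact ⟨l₁.flatMap Prod.snd, l₂.flatMap Prod.snd, by simp⟩

theorem exists_zip_of_forall₂ {α β γ : Type*} {f : α → β → γ} {l : List α} {m : List γ}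
    (h : List.Forall₂ (fun a c => ∃ b, c = f a b) l m) :
    ∃ D : List β, D.length = l.length ∧ m = (l.zip D).map fun q => f q.1 q.2 := by
  induction h with
  | nil => exact ⟨[], rfl, rfl⟩
  | cons h _ ih =>
    obtain ⟨b, rfl⟩ := h
    obtain ⟨D, hD, rfl⟩ := ih
    exact ⟨b :: D, by simp [hD], by simp⟩

/-- A self-similar approximating curve consists of images of its predecessor along the first
one. -/
theorem IsApproximation.exists_eq_flatMap_placeV {A : ℕ → List (Vertex d)}
    (h : IsApproximation A) (hs : SelfSimilar A) (k : ℕ) :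
    ∃ D : List (SPerm d × Bool), D.length = 2 ^ d ∧
      A (k + 1) = ((A 1).zip D).flatMap fun q => placeV k q.1 q.2 (A k) := by
  obtain ⟨L, hL, hA, hI⟩ := hs k
  have h1 : (A 1).length = 2 ^ d := by simpa using h.length_eq 1
  have hlen : ∀ l ∈ L, l.length = 2 ^ (d * k) := fun l hl => by
    obtain ⟨φ, -, rfl | rfl⟩ := hI l hl <;> simp [h.length_eq]
  have hp : 0 < 2 ^ (d * k) := by positivity
  have hf : List.Forall₂ (fun v C => ∃ γ, C = placeV k v γ (A k)) (A 1) L := by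
    rw [List.forall₂_iff_get]
    refine ⟨h1.trans hL.symm, fun i hi hi' => ?_⟩
    refine (hI _ (List.get_mem L ⟨i, hi'⟩)).exists_placeV
      (fun x hx => (h.mem_iff k x).2 hx) fun x hx j => ?_
    obtain ⟨r, hr⟩ := List.getElem?_of_mem hx
    have hr' : r < 2 ^ (d * k) := by
      rw [← hlen _ (List.get_mem L ⟨i, hi'⟩)]
      exact (List.getElem?_eq_some_iff.1 hr).1
    -- Piece `i` fills the positions from `i * 2 ^ (d * k)` on, so its vertices divided by `2 ^ k`
    -- give vertex `i` of `A 1`; thus the piece stays in that vertex's cube.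
    have hx2 : (A (1 + k))[i * 2 ^ (d * k) + r]? = some x := by
      rw [add_comm, ← hA, getElem?_flatten_of_length_eq hp hlen, mul_comm,
        Nat.mul_add_div hp, Nat.div_eq_of_lt hr', Nat.mul_add_mod, Nat.mod_eq_of_lt hr',
        add_zero, List.getElem?_eq_getElem hi']
      exact hr
    have h2 := h.getElem?_div 1 k hx2
    rw [mul_comm, Nat.mul_add_div hp, Nat.div_eq_of_lt hr', add_zero,
      List.getElem?_eq_getElem hi, Option.some_inj] at h2
    have hz : (0 : ℤ) < 2 ^ k := by positivity
    have h3 := Int.mul_ediv_self_le (x := x j) hz.ne'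
    have h4 := Int.lt_mul_ediv_self_add (x := x j) hz
    rw [List.get_eq_getElem, h2]
    exact ⟨h3, h4⟩
  obtain ⟨D, hD, hL'⟩ := exists_zip_of_forall₂ hf
  exact ⟨D, hD.trans h1, by rw [← hA, hL', List.flatMap_def]⟩

/-- The same images can be used at all levels. -/
theorem exists_forall_eq_flatMap_place [GrayFacts d] {P : ℕ → List (Vertex d × SPerm d)}
    (hP : ∀ k, inflate (P k) = (P (k + 1)).map Prod.fst) {V : List (Vertex d)}
    (h : ∀ k, ∃ D : List (SPerm d × Bool), D.length = 2 ^ d ∧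
      (P (k + 1)).map Prod.fst =
        (V.zip D).flatMap fun q => placeV k q.1 q.2 ((P k).map Prod.fst)) :
    ∃ D : List (SPerm d × Bool), D.length = 2 ^ d ∧
      ∀ k, P (k + 1) = (V.zip D).flatMap fun q => place k q.1 q.2 (P k) := by
  -- A decomposition of the vertices one level up is the inflation of a decomposition with states,
  -- and inflation is injective.
  have key : ∀ (D : List (SPerm d × Bool)) k, (P (k + 2)).map Prod.fst =
      ((V.zip D).flatMap fun q => placeV (k + 1) q.1 q.2 ((P (k + 1)).map Prod.fst)) →
      P (k + 1) = (V.zip D).flatMap fun q => place k q.1 q.2 (P k) := by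
    intro D k hD
    apply inflate_injective
    rw [hP, hD, inflate, List.flatMap_assoc]
    refine List.flatMap_congr fun q _ => ?_
    rw [← hP, ← inflate_place, inflate]
  have down : ∀ (D : List (SPerm d × Bool)) k,
      (P (k + 2) = (V.zip D).flatMap fun q => place (k + 1) q.1 q.2 (P (k + 1))) →
      P (k + 1) = (V.zip D).flatMap fun q => place k q.1 q.2 (P k) := by
    intro D k hD
    refine key D k ?_
    simp only [hD, List.map_flatMap, map_fst_place]
  choose D hD hDP using h
  -- Pigeonhole: one of finitely many lists occurs at arbitrarily high levels, and `down` carries it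
  -- to all lower ones. The index is shifted because `key` lowers the level by one.
  let f : ℕ → List.Vector (SPerm d × Bool) (2 ^ d) := fun k => ⟨D (k + 1), hD (k + 1)⟩
  obtain ⟨y, hy⟩ := Finite.exists_infinite_fiber f
  refine ⟨y.1, y.2, fun k => ?_⟩
  obtain ⟨n, hn, hkn⟩ := (Set.infinite_coe_iff.1 hy).exists_gt k
  have hn' : D (n + 1) = y.1 := congrArg Subtype.val hn
  have hv : P (n + 1) = (V.zip y.1).flatMap fun q => place n q.1 q.2 (P n) :=
    hn' ▸ key _ n (hDP (n + 1))
  obtain ⟨m, rfl⟩ := Nat.exists_eq_add_of_le hkn.le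
  clear hn hkn hn'
  induction m with
  | zero => exact hv
  | succ m ih => exact ih (down _ _ hv)

theorem place_zero_one (k : ℕ) (P : List (Vertex d × SPerm d)) :
    place k 0 (1, false) P = P := by simp [place]

theorem place_place_zero (k : ℕ) (v : Vertex d) (δ γ : SPerm d × Bool)
    (P : List (Vertex d × SPerm d)) :
    place k v γ (place k 0 δ P) = place k v (comp γ δ) P := by
  have h : ∀ s : SPerm d, γ.1 * (δ.1 * s * SPerm.flipIf d δ.2) * SPerm.flipIf d γ.2
      = γ.1 * δ.1 * s * SPerm.flipIf d (xor γ.2 δ.2) := fun s => by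
    rw [Bool.xor_comm, ← SPerm.flipIf_mul]; simp only [mul_assoc]
  simp [place, map_revIf, revIf_revIf, comp, act_mul, Function.comp_def, h]

/-- Curves that consist of images of their predecessors along a rotated Gray code curve are rotated
versions of curves that do so along the Gray code curve. -/
theorem eq_place_pattern {P : ℕ → List (Vertex d × SPerm d)} {D : List (SPerm d × Bool)}
    {s : SPerm d} (h0 : P 0 = [(0, s)])
    (h : ∀ k, P (k + 1) =
      ((block (0, s)).zip D).flatMap fun q => place k q.1 q.2 (P k)) :
    ∀ k, P k = place k 0 (s, false)
      (pattern (D.map fun γ => comp (s⁻¹, false) (comp γ (s, false))) k)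
  | 0 => by simp [h0, pattern, place]
  | k + 1 => by
    have hz : block (0, s) = (grayCurve d).map (act 1 s) := by
      simp [block]
    rw [h k, hz, pattern, eq_place_pattern h0 h k, List.zip_map_left, List.zip_map_right,
      List.flatMap_map, List.flatMap_map]
    conv_rhs => rw [place]
    simp only [revIf_false, List.map_flatMap]
    refine List.flatMap_congr fun q _ => ?_
    have := place_place 1 k q.1 (s, false) (comp (s⁻¹, false) (comp q.2 (s, false)))
      (pattern (D.map fun γ => comp (s⁻¹, false) (comp γ (s, false))) k)
    -- Conjugating the images by `s` accounts for starting from state `s` instead of `1`.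
    have hc : comp (s, false) (comp (s⁻¹, false) (comp q.2 (s, false))) = comp q.2 (s, false) := by
      simp [comp]
    rw [hc] at this
    simp only [Prod.map_fst, Prod.map_snd, id, place_place_zero]
    rw [← this, add_comm, place]
    rfl

/-- The structure of self-similar, hyperorthogonal, well-folded curves. -/
theorem exists_eq_placeV_curves [GrayFacts d] [StepFacts d] (hd : 0 < d)
    {A : ℕ → List (Vertex d)} (hA : IsApproximation A) (hw : ∀ k, WellFolded (A k))
    (hh : ∀ k, Hyperorthogonal (A k)) (hs : SelfSimilar A) :
    ∃ (s : SPerm d) (D : List (SPerm d × Bool)), D.length = 2 ^ d ∧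
      (∀ k, (pattern D k).IsChain Link) ∧ ∀ k, A k = placeV k 0 (s, false) (curves D k) := by
  have hP : ∀ k, ∃ S : List (Vertex d × SPerm d),
      S.map Prod.fst = A k ∧ inflate S = A (k + 1) ∧ S.IsChain Link := fun k => by
    obtain ⟨P, hP⟩ := (hw (k + 1)).exists_isInflation (by
      rw [hA.length_eq]
      exact (Nat.one_lt_two_pow (by positivity)).ne')
    obtain rfl := hP.unique (hA.inflation k)
    exact exists_states hP (hA.kCurve k).1.2.2 (hh (k + 1))
  choose P hPA hPI hPL using hP
  obtain ⟨s, h0⟩ : ∃ s, P 0 = [(0, s)] := by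
    have h0 := hPA 0
    rw [hA.zero] at h0
    obtain ⟨⟨v, s⟩, hp, hv⟩ := List.map_eq_singleton_iff.1 h0
    exact ⟨s, by rw [hp]; simpa using hv⟩
  have hA1 : A 1 = block (0, s) := by
    rw [← hPI 0, h0]
    simp [inflate]
  obtain ⟨D, hD, hPD⟩ := exists_forall_eq_flatMap_place (P := P) (V := A 1)
    (fun k => by rw [hPI, hPA]) fun k => by
      simpa only [hPA] using hA.exists_eq_flatMap_placeV hs k
  rw [hA1] at hPD
  have key := eq_place_pattern h0 hPD
  refine ⟨s, D.map fun γ => comp (s⁻¹, false) (comp γ (s, false)), by simpa using hD,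
    fun k => ?_, fun k => ?_⟩
  -- Undoing `s` turns the linked curve `P k` into `pattern` of the conjugated list.
  · have h1 := isChain_place k 0 (s⁻¹, false) (hPL k)
    rw [key k, place_place_zero] at h1
    have hc : comp (s⁻¹, false) (s, false) = ((1 : SPerm d), false) := by simp [comp]
    rwa [hc, place_zero_one] at h1
  · rw [← hPA k, key k, map_fst_place]
    rfl

/-- Reflecting and reversing all images reflects and reverses the curves. -/
theorem pattern_conj [GrayFacts d] (D : List (SPerm d × Bool)) (hD : D.length = 2 ^ d) :
    ∀ k, pattern
      ((D.map fun γ => comp (SPerm.flip d, true) (comp γ (SPerm.flip d, true))).reverse) k =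
      place k 0 (SPerm.flip d, true) (pattern D k)
  | 0 => by simp [pattern, place]
  | k + 1 => by
    set F : SPerm d × Bool := (SPerm.flip d, true)
    -- `F` is an involution: the inner `F` of the conjugate cancels the one in the induction
    -- hypothesis. The outer `F` then acts on the whole curve, as `hG` exhibits the Gray code curve
    -- as its own image.
    have hF : ∀ γ, comp (comp F (comp γ F)) F = comp F γ := fun γ => by
      simp [comp, F, mul_assoc]
    have hG : grayCurve d = (((grayCurve d).map (act 1 (SPerm.flip d)))).reverse := by
      rw [← GrayFacts.reverse_eq, List.reverse_reverse]
    rw [pattern, pattern_conj D hD k]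
    conv_lhs => rw [hG]
    have hzip : ∀ {α β : Type} (l : List α) (m : List β), l.length = m.length →
        l.reverse.zip m.reverse = (l.zip m).reverse := fun l m hlm => by
      rw [List.zip_eq_zipWith, List.zip_eq_zipWith, List.reverse_zipWith hlm]
    rw [hzip _ _ (by simp [hD, GrayFacts.length_eq]), List.zip_map, pattern, List.flatMap_reverse,
      List.flatMap_map]
    conv_rhs => rw [place]
    simp only [F, revIf_true, List.map_flatMap, List.reverse_inj]
    refine List.flatMap_congr fun q _ => ?_
    have := place_place 1 k q.1 F q.2 (pattern D k)
    simp only [Function.comp_apply, Prod.map_fst, Prod.map_snd, place_place_zero]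
    rw [hF, ← this, place, add_comm]
    simp [F]

/-! ### Codes of signed permutations -/

/-- The product of signed permutations in terms of codes. -/
def mulCode (g h : List (ℕ × Bool)) : List (ℕ × Bool) :=
  g.map fun x => ((h.getD x.1 (0, false)).1, xor x.2 (h.getD x.1 (0, false)).2)

theorem getElem?_code (s : SPerm d) (j : Fin d) :
    (code s)[(j : ℕ)]? = some ((s.perm j : ℕ), s.neg j) := by
  simp [code]

theorem code_mul (g h : SPerm d) : code (g * h) = mulCode (code g) (code h) := by
  refine List.ext_getElem (by simp [mulCode, code]) fun i hi hi' => ?_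
  simp [mulCode, code]

theorem code_injective : Function.Injective (code (d := d)) := by
  intro g h e
  have := List.ofFn_injective e
  simp only [funext_iff, Prod.mk.injEq] at this
  exact SPerm.ext (Equiv.ext fun j => Fin.ext (this j).1) (funext fun j => (this j).2)

/-- The codes of the first `n` coordinates of signed permutations, in reverse order. -/
def allCodes (d : ℕ) : ℕ → List (List (ℕ × Bool))
  | 0 => [[]]
  | n + 1 => (allCodes d n).flatMap fun c =>
      ((List.range d).filter fun i => (c.map Prod.fst).all fun k => i != k).flatMap fun i =>
        [(i, false) :: c, (i, true) :: c]

theorem mem_allCodes {c : List (ℕ × Bool)} :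
    c ∈ allCodes d c.length ↔ (∀ x ∈ c, x.1 < d) ∧ (c.map Prod.fst).Nodup := by
  induction c with
  | nil => simp [allCodes]
  | cons x c ih =>
    obtain ⟨i, b⟩ := x
    simp only [List.length_cons, allCodes, List.mem_flatMap, List.mem_filter, List.mem_range,
      List.mem_cons, List.cons.injEq, Prod.mk.injEq, List.not_mem_nil, or_false, List.all_eq_true,
      bne_iff_ne, forall_eq_or_imp, List.map_cons, List.nodup_cons]
    constructor
    · rintro ⟨c', hc', i', ⟨hi, hn⟩, h⟩
      obtain ⟨rfl, rfl⟩ : i = i' ∧ c = c' := by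
        rcases h with h | h
        · exact ⟨h.1.1, h.2⟩
        · exact ⟨h.1.1, h.2⟩
      obtain ⟨h1, h2⟩ := ih.1 hc'
      exact ⟨⟨hi, h1⟩, fun hm => hn i hm rfl, h2⟩
    · rintro ⟨⟨hi, h1⟩, hn, h2⟩
      refine ⟨c, ih.2 ⟨h1, h2⟩, i, ⟨hi, fun k hk e => hn (e ▸ hk)⟩, ?_⟩
      cases b <;> simp

theorem length_code (s : SPerm d) : (code s).length = d := by simp [code]

theorem code_mem_allCodes (s : SPerm d) : code s ∈ allCodes d d := by
  have : code s ∈ allCodes d (code s).length := by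
    rw [mem_allCodes]
    constructor
    · simp [code, List.mem_ofFn]
    · rw [code, List.map_ofFn, List.nodup_ofFn]
      exact Fin.val_injective.comp s.perm.injective
  rwa [length_code] at this

theorem exists_code {m : List (ℕ × Bool)} (h : m ∈ allCodes d d) : ∃ s : SPerm d, code s = m := by
  have hlen : ∀ (n : ℕ) {c : List (ℕ × Bool)}, c ∈ allCodes d n → c.length = n := by
    intro n
    induction n with
    | zero => simp [allCodes]
    | succ n ih =>
      intro c hc
      simp only [allCodes, List.mem_flatMap, List.mem_cons, List.not_mem_nil, or_false] at hc
      obtain ⟨c', hc', i, -, rfl | rfl⟩ := hc <;> simp [ih hc']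
  have hl := hlen d h
  have h' := mem_allCodes.1 (show m ∈ allCodes d m.length by rwa [hl])
  have hj : ∀ j : Fin d, (j : ℕ) < m.length := fun j => hl ▸ j.2
  let f : Fin d → Fin d := fun j => ⟨(m[(j : ℕ)]'(hj j)).1, h'.1 _ (List.getElem_mem _)⟩
  have hf : Function.Injective f := by
    intro i j hij
    have h1 : (m.map Prod.fst)[(i : ℕ)]'(by simpa using hj i) =
        (m.map Prod.fst)[(j : ℕ)]'(by simpa using hj j) := by
      simpa [f] using hij
    exact Fin.ext ((List.Nodup.getElem_inj_iff h'.2).1 h1)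
  refine ⟨⟨Equiv.ofBijective f (Finite.injective_iff_bijective.1 hf),
    fun j => (m[(j : ℕ)]'(hj j)).2⟩, ?_⟩
  refine List.ext_getElem (by rw [length_code, hl]) fun i hi hi' => ?_
  simp [code, f]

/-! ### Hyperorthogonality as a property of the word of axes -/

/-- The `i`-th element of `l` is the axis of the `i`-th edge of the curve. -/
def AxisWord : List (Vertex d) → List (Fin d) → Prop
  | [_], [] => True
  | v :: w :: C, a :: l => (∀ j, v j ≠ w j ↔ j = a) ∧ AxisWord (w :: C) l
  | _, _ => False

instance decidableAxisWord : ∀ (C : List (Vertex d)) (l : List (Fin d)), Decidable (AxisWord C l)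
  | [], _ => .isFalse id
  | [_], [] => .isTrue trivial
  | [_], _ :: _ => .isFalse id
  | _ :: _ :: _, [] => .isFalse id
  | v :: w :: C, a :: l =>
    haveI := decidableAxisWord (w :: C) l
    inferInstanceAs (Decidable ((∀ j, v j ≠ w j ↔ j = a) ∧ AxisWord (w :: C) l))

theorem AxisWord.length_eq : ∀ {C : List (Vertex d)} {l : List (Fin d)},
    AxisWord C l → C.length = l.length + 1
  | [_], [], _ => rfl
  | _ :: w :: C, _ :: l, h => by
    have := AxisWord.length_eq h.2
    simp only [List.length_cons] at this ⊢
    omega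

theorem AxisWord.axes_eq : ∀ {C : List (Vertex d)} {l : List (Fin d)},
    AxisWord C l → axes C = {j | j ∈ l}
  | [v], [], _ => by
    ext j
    simp only [axes, Set.mem_ofPred_eq, List.not_mem_nil, iff_false]
    rintro ⟨a, b, h, -⟩
    simpa using h.length_le
  | v :: w :: C, a :: l, h => by
    have ih := AxisWord.axes_eq h.2
    ext j
    have ihj : j ∈ axes (w :: C) ↔ j ∈ l := by rw [ih]; rfl
    simp only [Set.mem_ofPred_eq, List.mem_cons]
    rw [← ihj, ← h.1 j]
    constructor
    · rintro ⟨x, y, hxy, hne⟩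
      rcases List.infix_cons_iff.1 hxy with hp | hp
      · simp only [List.cons_prefix_cons] at hp
        rw [hp.1, hp.2.1] at hne
        exact Or.inl hne
      · exact Or.inr ⟨x, y, hp, hne⟩
    · rintro (hne | ⟨x, y, hxy, hne⟩)
      · exact ⟨v, w, ⟨[], C, rfl⟩, hne⟩
      · exact ⟨x, y, List.infix_cons_iff.2 (Or.inr hxy), hne⟩

theorem AxisWord.drop : ∀ (i : ℕ) {C : List (Vertex d)} {l : List (Fin d)},
    AxisWord C l → i ≤ l.length → AxisWord (C.drop i) (l.drop i)
  | 0, _, _, h, _ => by simpa using h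
  | i + 1, [_], [], _, hi => by simp at hi
  | i + 1, _ :: w :: C, _ :: l, h, hi => by
    simpa using AxisWord.drop i h.2 (by simpa using hi)

theorem AxisWord.take : ∀ (m : ℕ) {C : List (Vertex d)} {l : List (Fin d)},
    AxisWord C l → AxisWord (C.take (m + 1)) (l.take m)
  | 0, [_], [], _ => trivial
  | 0, _ :: _ :: _, _ :: _, _ => trivial
  | _ + 1, [_], [], _ => trivial
  | m + 1, _ :: _ :: _, _ :: _, h => ⟨h.1, AxisWord.take m h.2⟩

theorem AxisWord.append : ∀ {C C' : List (Vertex d)} {l l' : List (Fin d)} {a : Fin d},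
    AxisWord C l → AxisWord C' l' →
    (∀ x ∈ C.getLast?, ∀ y ∈ C'.head?, ∀ j, x j ≠ y j ↔ j = a) →
    AxisWord (C ++ C') (l ++ a :: l')
  | [v], w :: C', [], l', a, _, h', ha => ⟨ha v rfl w rfl, h'⟩
  | [v], [], [], l', a, _, h', _ => by cases l' <;> exact absurd h' id
  | v :: w :: C, C', b :: l, l', a, h, h', ha =>
    ⟨h.1, AxisWord.append h.2 h' (by simpa using ha)⟩

theorem AxisWord.map (k : ℕ) (v : Vertex d) (g : SPerm d) :
    ∀ {C : List (Vertex d)} {l : List (Fin d)}, AxisWord C l →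
      AxisWord (C.map fun x => shift k v (act k g x)) (l.map g.perm.symm)
  | [_], [], _ => trivial
  | x :: y :: C, a :: l, h => by
    refine ⟨fun j => ?_, AxisWord.map k v g h.2⟩
    rw [Equiv.eq_symm_apply, ← h.1]
    simp only [shift, act]
    split <;> simp

/-- Hyperorthogonality in terms of the axes of the edges. -/
def HyperWord {α : Type*} [DecidableEq α] (d : ℕ) (l : List α) : Prop :=
  ∀ n < d - 1, ∀ i < l.length + 1 - 2 ^ n, ((l.drop i).take (2 ^ n)).dedup.length = n + 1

instance {α : Type*} [DecidableEq α] (d : ℕ) (l : List α) : Decidable (HyperWord d l) :=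
  inferInstanceAs (Decidable (∀ n < d - 1, ∀ i < l.length + 1 - 2 ^ n, _ = _))

theorem hyperWord_map {α β : Type*} [DecidableEq α] [DecidableEq β] {f : α → β}
    (hf : Function.Injective f) (l : List α) : HyperWord d (l.map f) ↔ HyperWord d l := by
  simp only [HyperWord, List.length_map, ← List.map_drop, ← List.map_take,
    List.dedup_map_of_injective hf]

theorem infix_iff_exists_drop_take {α : Type*} {S C : List α} :
    S <:+: C ↔ ∃ i, i + S.length ≤ C.length ∧ S = (C.drop i).take S.length := by
  constructor
  · rintro ⟨a, b, rfl⟩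
    exact ⟨a.length, by simp, by simp⟩
  · rintro ⟨i, -, h⟩
    rw [h]
    exact (List.take_prefix _ _).isInfix.trans (List.drop_suffix _ _).isInfix

/-- A window of `2 ^ n + 1` vertices is a window of `2 ^ n` letters, and its axes are the distinct
letters. This makes the property decidable by computation. -/
theorem AxisWord.hyperorthogonal_iff {C : List (Vertex d)} {l : List (Fin d)}
    (h : AxisWord C l) : Hyperorthogonal C ↔ HyperWord d l := by
  have hl := h.length_eq
  have key : ∀ n i, i + 2 ^ n ≤ l.length → (axes ((C.drop i).take (2 ^ n + 1))).ncard =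
      ((l.drop i).take (2 ^ n)).dedup.length := fun n i hi => by
    have hn : 0 < 2 ^ n := by positivity
    rw [((h.drop i (by omega)).take (2 ^ n)).axes_eq, ← List.card_toFinset,
      ← Set.ncard_coe_finset]
    congr 1
    ext j
    simp
  constructor
  · intro hC n hn i hi
    -- The bound in `HyperWord` uses truncated subtraction; it holds exactly when the window fits
    -- into the word.
    have hi' : i + 2 ^ n ≤ l.length := by omega
    have hlen : ((C.drop i).take (2 ^ n + 1)).length = 2 ^ n + 1 := by simp; omega
    rw [← key n i hi']
    exact hC n (by omega) _ (infix_iff_exists_drop_take.2 ⟨i, by omega, by rw [hlen]⟩) hlen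
  · intro hl' n hn S hS hSl
    obtain ⟨i, hi, hS'⟩ := infix_iff_exists_drop_take.1 hS
    rw [hSl] at hi hS'
    rw [hS', key n i (by omega)]
    exact hl' n (by omega) i (by omega)

/-! ### Verification of the step relation -/

/-- The axes of the edges of the Gray code curve. -/
def grayWord : (d : ℕ) → List (Fin d)
  | 0 => []
  | d + 1 => (grayWord d).map Fin.castSucc ++ Fin.last d :: (grayWord d).reverse.map Fin.castSucc

/-- The coordinates in which the end of a child curve with state `1` and the start of a child curve
with the given state differ. -/
def stepAxes (d : ℕ) (c : List (ℕ × Bool)) : List (Fin d) :=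
  (List.finRange d).filter fun j => (c.getD j (0, false)).2 != decide ((j : ℕ) + 1 = d)

/-- A test whether child curves with state `1` and the given state may follow each other. -/
def stepTest (d : ℕ) (c : List (ℕ × Bool)) : Bool :=
  match stepAxes d c with
  | [e] => decide (HyperWord d (((grayWord d).map fun j : Fin d => (c.getD j (0, false)).1) ++
      (c.getD e (0, false)).1 :: (grayWord d).map fun j : Fin d => (j : ℕ)))
  | _ => false

theorem exit_one_apply (j : Fin d) :
    exit (1 : SPerm d) j = if (j : ℕ) + 1 = d then 1 else 0 := by
  simp [exit, entry, SPerm.flip]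

theorem exit_one_sub_entry_sq (u : SPerm d) (j : Fin d) :
    (exit 1 - entry u : Vertex d) j ^ 2 =
      if (u.neg j != decide ((j : ℕ) + 1 = d)) = true then 1 else 0 := by
  rw [Pi.sub_apply, exit_one_apply, entry]
  by_cases h : (j : ℕ) + 1 = d <;> by_cases h' : u.neg j = true <;> simp [h, h']

theorem mem_stepAxes (u : SPerm d) (j : Fin d) :
    j ∈ stepAxes d (code u) ↔ exit 1 j ≠ entry u j := by
  have : exit 1 j ≠ entry u j ↔ (exit 1 - entry u : Vertex d) j ^ 2 ≠ 0 := by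
    rw [Pi.sub_apply, ne_eq, ne_eq, sq_eq_zero_iff, sub_eq_zero]
  rw [this, exit_one_sub_entry_sq]
  simp [stepAxes, getElem?_code]

theorem isEdge_exit_sub_entry_iff (u : SPerm d) :
    IsEdge 0 (exit 1 - entry u) ↔ (stepAxes d (code u)).length = 1 := by
  have h : (stepAxes d (code u)).length =
      (Finset.univ.filter fun j : Fin d => (u.neg j != decide ((j : ℕ) + 1 = d)) = true).card := by
    rw [stepAxes, ← List.toFinset_card_of_nodup ((List.nodup_finRange d).filter _)]
    congr 1
    ext j
    simp [getElem?_code]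
  rw [h, IsEdge]
  simp only [Pi.zero_apply, sub_zero, exit_one_sub_entry_sq]
  rw [Finset.sum_boole]
  exact_mod_cast Iff.rfl

theorem axisWord_blockPair [GrayFacts d] (hG : AxisWord (grayCurve d) (grayWord d)) {u : SPerm d}
    {e : Fin d} (he : stepAxes d (code u) = [e]) :
    AxisWord (blockPair u) (grayWord d ++ e :: (grayWord d).map u.perm.symm) := by
  have h1 : block ((0, 1) : Vertex d × SPerm d) = grayCurve d := block_zero_one
  rw [blockPair]
  refine AxisWord.append (h1 ▸ hG) (hG.map 1 _ u) ?_
  rw [block_getLast?, block_head?]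
  rintro _ ⟨⟩ _ ⟨⟩ j
  have := mem_stepAxes u j
  rw [he, List.mem_singleton] at this
  rw [this]
  simp only [shift, Pi.zero_apply, Pi.sub_apply]
  omega

/-- The word of a `blockPair` involves `u.perm.symm`. Renaming all axes by `u.perm` preserves
hyperorthogonality and leaves only `u.perm`, which the code contains, so the test inverts nothing.
-/
theorem isStep_iff_of_stepTest [GrayFacts d] (hG : AxisWord (grayCurve d) (grayWord d))
    (h : ∀ c ∈ allCodes d d, stepTest d c = decide (c ∈ stepCodes d)) (u : SPerm d) :
    IsStep u ↔ IsEdge 0 (exit 1 - entry u) ∧ Hyperorthogonal (blockPair u) := by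
  have h1 : IsStep u ↔ stepTest d (code u) = true := by
    rw [h _ (code_mem_allCodes u), decide_eq_true_iff, IsStep]
  rw [h1, isEdge_exit_sub_entry_iff, stepTest, List.length_eq_one_iff]
  constructor
  · intro ht
    split at ht
    · rename_i e he
      refine ⟨⟨e, he⟩, ?_⟩
      rw [(axisWord_blockPair hG he).hyperorthogonal_iff,
        ← hyperWord_map (Fin.val_injective.comp u.perm.injective)]
      simpa [getElem?_code, Function.comp_def] using of_decide_eq_true ht
    · simp at ht
  · rintro ⟨⟨e, he⟩, hh⟩
    rw [(axisWord_blockPair hG he).hyperorthogonal_iff,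
      ← hyperWord_map (Fin.val_injective.comp u.perm.injective)] at hh
    rw [he]
    refine decide_eq_true ?_
    simpa [getElem?_code, Function.comp_def] using hh

/-- The code of the reflection in the last axis. -/
def flipCode (d : ℕ) : List (ℕ × Bool) := (List.range d).map fun j => (j, decide (j + 1 = d))

theorem code_flip : code (SPerm.flip d) = flipCode d := by
  refine List.ext_getElem (by simp [code, flipCode]) fun i hi hi' => ?_
  simp [code, flipCode, SPerm.flip]

/-- The inverse is avoided: the reversed step is the solution `c'` of `u * flip * c' = flip`. -/
theorem isStep_reverse_of_codes
    (h : ∀ c ∈ stepCodes d, ∀ c' ∈ allCodes d d,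
      mulCode (mulCode c (flipCode d)) c' = flipCode d → c' ∈ stepCodes d)
    (u : SPerm d) (hu : IsStep u) : IsStep (SPerm.flip d * u⁻¹ * SPerm.flip d) := by
  refine h _ hu _ (code_mem_allCodes _) ?_
  rw [← code_flip, ← code_mul, ← code_mul]
  congr 1
  have : u * SPerm.flip d * (SPerm.flip d * u⁻¹ * SPerm.flip d) =
      u * (SPerm.flip d * SPerm.flip d) * u⁻¹ * SPerm.flip d := by simp only [mul_assoc]
  rw [this, SPerm.flip_mul_flip, mul_one, mul_inv_cancel, one_mul]

instance : StepFacts 3 where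
  isStep_iff := isStep_iff_of_stepTest (by decide +kernel) (by decide +kernel)
  isStep_one := show code (1 : SPerm 3) ∈ stepCodes 3 by decide +kernel
  isStep_reverse := isStep_reverse_of_codes (by decide +kernel)

instance : StepFacts 4 where
  isStep_iff := isStep_iff_of_stepTest (by decide +kernel) (by decide +kernel)
  isStep_one := show code (1 : SPerm 4) ∈ stepCodes 4 by decide +kernel
  isStep_reverse := isStep_reverse_of_codes (by decide +kernel)

/-! ### Links in terms of codes -/

/-- The vertices of the Gray code curve. -/
def grayBits : ℕ → List (List Bool)
  | 0 => [[]]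
  | d + 1 => (grayBits d).map (fun b => b ++ [false]) ++
      (grayBits d).reverse.map fun b => b ++ [true]

/-- The vertex with the given coordinates. -/
def ofBits (d : ℕ) (b : List Bool) : Vertex d := fun j => if b.getD j false then 1 else 0

/-- The coordinates of the corner at which the child curve of the given state starts. -/
def entryBit (c : List (ℕ × Bool)) (j : ℕ) : ℕ := (c.getD j (0, false)).2.toNat

/-- The coordinates of the corner at which the child curve of the given state ends. -/
def exitBit (d : ℕ) (c : List (ℕ × Bool)) (j : ℕ) : ℕ := entryBit (mulCode c (flipCode d)) j

/-- The condition on the corners in `Link`. -/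
def cornerTest (d : ℕ) (b b' : List Bool) (x y : List (ℕ × Bool)) : Bool :=
  (List.range d).all fun j =>
    (b'.getD j false).toNat + entryBit y j == (b.getD j false).toNat + exitBit d x j

/-- The value of `f` at `x`, to be evaluated only when `x` is known. -/
def force {β : Type*} : List (ℕ × Bool) → (List (ℕ × Bool) → β) → β
  | [], f => f []
  | (n, b) :: c, f => force c fun c => match n, b with
    | 0, false => f ((0, false) :: c)
    | 0, true => f ((0, true) :: c)
    | 1, false => f ((1, false) :: c)
    | 1, true => f ((1, true) :: c)
    | 2, false => f ((2, false) :: c)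
    | 2, true => f ((2, true) :: c)
    | 3, false => f ((3, false) :: c)
    | 3, true => f ((3, true) :: c)
    | n, b => f ((n, b) :: c)

theorem force_eq {β : Type*} : ∀ (c : List (ℕ × Bool)) (f : List (ℕ × Bool) → β), force c f = f c
  | [], _ => rfl
  | (n, b) :: c, f => by
    rw [force, force_eq c]
    split <;> rfl

/-- The relation `Link` in terms of codes. -/
def linkTest (d : ℕ) (b b' : List Bool) (x y : List (ℕ × Bool)) : Bool :=
  cornerTest d b b' x y && ((stepCodes d).map (mulCode x)).contains y

theorem entry_eq_entryBit (s : SPerm d) (j : Fin d) : entry s j = entryBit (code s) j := by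
  simp only [entry, entryBit, List.getD_eq_getElem?_getD, getElem?_code, Option.getD_some]
  cases s.neg j <;> simp

theorem exit_eq_exitBit (s : SPerm d) (j : Fin d) : exit s j = exitBit d (code s) j := by
  rw [exit, entry_eq_entryBit, code_mul, code_flip, exitBit]

theorem ofBits_apply (b : List Bool) (j : Fin d) : ofBits d b j = (b.getD j false).toNat := by
  simp only [ofBits]
  cases b.getD j false <;> simp

theorem cornerTest_iff {b b' : List Bool} {s t : SPerm d} :
    cornerTest d b b' (code s) (code t) = true ↔
      ofBits d b' - ofBits d b = exit s - entry t := by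
  simp only [cornerTest, List.all_eq_true, List.mem_range, beq_iff_eq, funext_iff, Pi.sub_apply,
    exit_eq_exitBit, entry_eq_entryBit, ofBits_apply]
  constructor
  · intro h j
    have := h j j.2
    omega
  · intro h j hj
    have := h ⟨j, hj⟩
    simp only at this
    omega

/-- The code of the identity. -/
def oneCode (d : ℕ) : List (ℕ × Bool) := (List.range d).map fun j => (j, false)

theorem code_one : code (1 : SPerm d) = oneCode d := by
  refine List.ext_getElem (by simp [code, oneCode]) fun i hi hi' => ?_
  simp [code, oneCode]

/-- The elements of `stepCodes`, grouped by the axis and the sign of the edge between the child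
curves. -/
def stepGroups : ℕ → List ((ℕ × Bool) × List (List (ℕ × Bool)))
  | 3 => [((2, false), [[(0, false), (1, false), (2, false)],
        [(0, false), (2, false), (1, false)],
        [(1, false), (0, false), (2, false)],
        [(2, false), (0, false), (1, false)]]),
      ((1, true), [[(0, false), (1, true), (2, true)],
        [(0, false), (2, true), (1, true)],
        [(1, false), (2, true), (0, true)],
        [(2, false), (1, true), (0, true)]])]
  | 4 => [((3, false), [[(0, false), (1, false), (2, false), (3, false)],
        [(0, false), (1, false), (3, false), (2, false)],
        [(0, false), (2, false), (1, false), (3, false)],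
        [(0, false), (3, false), (1, false), (2, false)],
        [(1, false), (0, false), (2, false), (3, false)],
        [(1, false), (0, false), (3, false), (2, false)]]),
      ((2, true), [[(0, false), (1, false), (2, true), (3, true)],
        [(0, false), (1, false), (3, true), (2, true)],
        [(0, false), (2, false), (3, true), (1, true)],
        [(0, false), (3, false), (2, true), (1, true)],
        [(1, false), (0, false), (2, true), (3, true)],
        [(1, false), (0, false), (3, true), (2, true)]])]
  | _ => []

/-- Properties of the concrete lists for one dimension; they are checked where they are needed. -/
class CodeFacts (d : ℕ) : Prop where
  grayCurve_eq : grayCurve d = (grayBits d).map (ofBits d)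
  mem_allCodes_of_mem : ∀ c ∈ stepCodes d, c ∈ allCodes d d
  exists_group : ∀ c ∈ stepCodes d, ∃ p ∈ stepGroups d, p.1.1 < d ∧ c ∈ p.2 ∧ ∀ j < d,
    (exitBit d (oneCode d) j : ℤ) - entryBit c j =
      if j = p.1.1 then (if p.1.2 then -1 else 1) else 0

theorem isStep_iff_mem [CodeFacts d] {s t : SPerm d} :
    IsStep (s⁻¹ * t) ↔ code t ∈ (stepCodes d).map (mulCode (code s)) := by
  rw [IsStep, List.mem_map]
  constructor
  · exact fun h => ⟨_, h, by rw [← code_mul, mul_inv_cancel_left]⟩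
  · rintro ⟨u, hu, h⟩
    obtain ⟨w, rfl⟩ := exists_code (CodeFacts.mem_allCodes_of_mem u hu)
    rw [← code_mul] at h
    rwa [← code_injective h, inv_mul_cancel_left]

theorem link_iff_linkTest [CodeFacts d] {b b' : List Bool} {s t : SPerm d} :
    Link (ofBits d b, s) (ofBits d b', t) ↔ linkTest d b b' (code s) (code t) = true := by
  rw [linkTest, Bool.and_eq_true, cornerTest_iff, List.contains_iff_mem, ← isStep_iff_mem]
  rfl

/-! ### The search for lists of images -/

/-- All walks from `s` along the list, where `next` gives the possible successors, and `ev` evaluates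
a function. -/
def search {α β : Type*} (ev : α → (α → List (List α)) → List (List α))
    (next : β → β → α → List α) : List β → α → List (List α)
  | b :: b' :: l, s => (next b b' s).flatMap fun t => ev t fun t =>
      (search ev next (b' :: l) t).map fun S => s :: S
  | _, s => [[s]]

/-- Completeness of the search is all that the classification needs. -/
theorem mem_search {α β : Type*} {ev : α → (α → List (List α)) → List (List α)}
    (hev : ∀ t f, ev t f = f t) {next : β → β → α → List α} :
    ∀ {l : List β} {s : α} {S : List α}, l.length = S.length + 1 →
      (l.zip (s :: S)).IsChain (fun p q => q.2 ∈ next p.1 q.1 p.2) →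
      s :: S ∈ search ev next l s
  | [b], s, [], _, _ => by simp [search]
  | b :: b' :: l, s, t :: S, hl, h => by
    simp only [List.zip_cons_cons, List.isChain_cons_cons] at h
    rw [search, List.mem_flatMap]
    refine ⟨t, h.1, ?_⟩
    rw [hev]
    refine List.mem_map_of_mem (mem_search hev (by simpa using hl) ?_)
    rw [List.zip_cons_cons]
    exact h.2

/-- The code of a signed permutation with reversal: the state of the image of the state `1`, and
whether the image is reversed. -/
def key (γ : SPerm d × Bool) : List (ℕ × Bool) × Bool := (code (γ.1 * SPerm.flipIf d γ.2), γ.2)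

theorem key_injective : Function.Injective (key (d := d)) := by
  rintro ⟨g, r⟩ ⟨h, r'⟩ e
  simp only [key, Prod.mk.injEq] at e
  obtain ⟨e, rfl⟩ := e
  rw [mul_right_cancel (code_injective e)]

theorem exists_map_key {K : List (List (ℕ × Bool) × Bool)}
    (h : ∀ p ∈ K, p.1 ∈ allCodes d d) : ∃ D : List (SPerm d × Bool), D.map key = K := by
  induction K with
  | nil => exact ⟨[], rfl⟩
  | cons p K ih =>
    obtain ⟨D, rfl⟩ := ih fun q hq => h q (List.mem_cons_of_mem _ hq)
    obtain ⟨s, hs⟩ := exists_code (h p List.mem_cons_self)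
    refine ⟨(s * SPerm.flipIf d p.2, p.2) :: D, ?_⟩
    simp [key, mul_assoc, SPerm.flipIf_mul, hs]

/-- The codes of `ends`. -/
def endsCode (d : ℕ) (p : List (ℕ × Bool) × Bool) (e : List (ℕ × Bool) × List (ℕ × Bool)) :
    List (ℕ × Bool) × List (ℕ × Bool) :=
  if p.2 then
    (mulCode (mulCode (mulCode p.1 (flipCode d)) e.2) (flipCode d),
      mulCode (mulCode (mulCode p.1 (flipCode d)) e.1) (flipCode d))
  else (mulCode p.1 e.1, mulCode p.1 e.2)

/-- The codes of a pair of signed permutations. -/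
def codes (e : SPerm d × SPerm d) : List (ℕ × Bool) × List (ℕ × Bool) := (code e.1, code e.2)

theorem codes_ends (γ : SPerm d × Bool) (e : SPerm d × SPerm d) :
    codes (ends γ e) = endsCode d (key γ) (codes e) := by
  obtain ⟨g, r⟩ := γ
  cases r <;> simp [codes, ends, endsCode, key, ← code_flip, ← code_mul, mul_assoc]

/-- The condition in `Fits` for two consecutive images. -/
def fitsTest (d : ℕ) (e : List (ℕ × Bool) × List (ℕ × Bool))
    (q q' : List Bool × (List (ℕ × Bool) × Bool)) : Bool :=
  linkTest d q.1 q'.1 (endsCode d q.2 e).2 (endsCode d q'.2 e).1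

theorem fits_iff [CodeFacts d] {D : List (SPerm d × Bool)} {e : SPerm d × SPerm d} :
    Fits D e ↔ ((grayBits d).zip (D.map key)).IsChain
      fun q q' => fitsTest d (codes e) q q' = true := by
  rw [Fits, CodeFacts.grayCurve_eq, List.zip_map_left, List.zip_map_right, List.isChain_map,
    List.isChain_map]
  simp only [Prod.map_fst, Prod.map_snd, id, link_iff_linkTest, fitsTest, ← codes_ends]
  rfl

/-- The possible successors of a state along an edge of the Gray code curve. -/
def nextStates (d : ℕ) (b b' : List Bool) (s : List (ℕ × Bool)) : List (List (ℕ × Bool)) :=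
  match (List.range d).find? fun a => b.getD a false != b'.getD a false with
  | some a => (stepGroups d).flatMap fun p =>
      if (s.getD a (0, false)).1 == p.1.1 && xor (s.getD a (0, false)).2 p.1.2 == b.getD a false
      then p.2.map (mulCode s) else []
  | none => []

/-- Seen from state `s`, the edge to the next child curve is a signed unit vector that depends only
on the relative state, as recorded in `stepGroups`. Its image under `s` must be the edge from `b` to
`b'`, which fixes axis and sign. -/
theorem mem_nextStates [CodeFacts d] {b b' : List Bool} {s t : SPerm d}
    (h : Link (ofBits d b, s) (ofBits d b', t)) : code t ∈ nextStates d b b' (code s) := by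
  obtain ⟨u, rfl⟩ : ∃ u, t = s * u := ⟨s⁻¹ * t, by simp⟩
  obtain ⟨h1, h2⟩ := h
  rw [inv_mul_cancel_left] at h2
  obtain ⟨p, hp, hpd, hup, he⟩ := CodeFacts.exists_group _ h2
  have he' : ∀ i : Fin d, (exit 1 - entry u : Vertex d) i =
      if (i : ℕ) = p.1.1 then (if p.1.2 then -1 else 1) else 0 := fun i => by
    rw [Pi.sub_apply, exit_eq_exitBit, entry_eq_entryBit, code_one]
    exact he i i.2
  have h3 : ∀ j : Fin d, ofBits d b' j - ofBits d b j =
      if s.neg j then -(if (s.perm j : ℕ) = p.1.1 then (if p.1.2 then -1 else 1) else 0)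
      else if (s.perm j : ℕ) = p.1.1 then (if p.1.2 then -1 else 1) else 0 := fun j => by
    have := congrFun h1 j
    simp only [Pi.sub_apply] at this
    rw [this, ← Pi.sub_apply]
    have e : exit s - entry (s * u) = act 0 s (exit 1 - entry u) := by
      rw [← act_sub_act 1, act_one_exit, act_one_entry, mul_one]
    rw [e]
    simp only [act, he']
    simp
  simp only [ofBits_apply] at h3
  -- A coordinate that changes decreases exactly if its old bit is set.
  have signs : (∀ x y b b' : Bool, ((b'.toNat : ℤ) - b.toNat =
      if x then -(if y then -1 else 1) else if y then -1 else 1) → xor x y = b) ∧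
      ∀ x b b' : Bool, ((b'.toNat : ℤ) - b.toNat = if x then -0 else 0) → b = b' := by
    decide
  rw [nextStates]
  split
  · rename_i a ha
    have ha1 := List.find?_some ha
    have had : a < d := List.mem_range.1 (List.mem_of_find?_eq_some ha)
    have h4 := h3 ⟨a, had⟩
    have hc := getElem?_code s ⟨a, had⟩
    simp only at h4 hc
    rw [List.mem_flatMap]
    refine ⟨p, hp, ?_⟩
    rw [List.getD_eq_getElem?_getD, hc, Option.getD_some]
    by_cases hk : (s.perm ⟨a, had⟩ : ℕ) = p.1.1
    · rw [if_pos]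
      · rw [code_mul]
        exact List.mem_map_of_mem hup
      · simp only [hk, if_true] at h4
        simpa [hk] using signs.1 _ _ _ _ h4
    · simp only [hk, if_false] at h4
      exact absurd (signs.2 _ _ _ h4) (bne_iff_ne.1 ha1)
  -- This case is void: the coordinate that `s` reads from the axis of the edge does change.
  · rename_i hn
    rw [List.find?_eq_none] at hn
    obtain ⟨p0, hp0⟩ : ∃ j : Fin d, (s.perm j : ℕ) = p.1.1 :=
      ⟨s.perm.symm ⟨p.1.1, hpd⟩, by simp⟩
    have := hn p0 (List.mem_range.2 p0.2)
    have h4 := h3 p0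
    simp only [bne_iff_ne, ne_eq, not_not] at this
    rw [this, sub_self] at h4
    simp only [hp0, if_true] at h4
    split_ifs at h4 <;> omega

/-- The possible choices of reversal after a given one. -/
def nextReversals (d : ℕ) (e : List (ℕ × Bool) × List (ℕ × Bool))
    (q q' : List Bool × List (ℕ × Bool)) (r : Bool) : List Bool :=
  [false, true].filter fun r' => fitsTest d e (q.1, q.2, r) (q'.1, q'.2, r')

/-- The possible choices of reversal for a list of states. -/
def reversals (d : ℕ) (S : List (List (ℕ × Bool))) : List (List Bool) :=
  [false, true].flatMap
    (search (fun r f => f r) (nextReversals d (S.headD [], S.getLastD [])) ((grayBits d).zip S))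

/-- The codes of all lists that satisfy the conditions on curves up to the third one. -/
def solutions (d : ℕ) : List (List (List (ℕ × Bool) × Bool)) :=
  ((allCodes d d).flatMap (search force (nextStates d) (grayBits d))).flatMap fun S =>
    (reversals d S).map fun R => S.zip R

theorem length_grayBits [GrayFacts d] [CodeFacts d] : (grayBits d).length = 2 ^ d := by
  rw [← GrayFacts.length_eq, CodeFacts.grayCurve_eq, List.length_map]

/-- A single vertex has the same state at both ends, so at level 0 the reversals play no role. This
lets the search find the states first and the reversals afterwards. -/
theorem codes_ends_one (γ : SPerm d × Bool) :
    codes (ends γ (1, 1)) = ((key γ).1, (key γ).1) := by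
  obtain ⟨g, r⟩ := γ
  cases r <;> simp [codes, ends, key]

theorem mem_solutions [GrayFacts d] [CodeFacts d] {D : List (SPerm d × Bool)}
    (hD : D.length = 2 ^ d) {a b : SPerm d × Bool} (ha : D.head? = some a)
    (hb : D.getLast? = some b) (h1 : Fits D (1, 1))
    (h2 : Fits D ((ends a (1, 1)).1, (ends b (1, 1)).2)) : D.map key ∈ solutions d := by
  obtain ⟨D', rfl⟩ : ∃ D', D = a :: D' := by
    cases D with
    | nil => simp at ha
    | cons x D' => exact ⟨D', by simpa using ha⟩
  have hl := length_grayBits (d := d)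
  have hsplit : ∀ D : List (SPerm d × Bool),
      D.map key = (D.map fun γ => (key γ).1).zip (D.map fun γ => γ.2) := fun D => by
    rw [List.zip_map']; rfl
  rw [solutions, List.mem_flatMap]
  refine ⟨(a :: D').map fun γ => (key γ).1, ?_, ?_⟩
  · rw [List.mem_flatMap]
    refine ⟨(key a).1, code_mem_allCodes _, mem_search force_eq (by simpa [hl] using hD.symm) ?_⟩
    have : (key a).1 :: D'.map (fun γ => (key γ).1) = (a :: D').map fun γ => (key γ).1 := rfl
    rw [this, List.zip_map_right, List.isChain_map]
    rw [Fits, CodeFacts.grayCurve_eq, List.zip_map_left, List.isChain_map] at h1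
    refine h1.imp fun q q' hq => ?_
    simp only [Prod.map_fst, Prod.map_snd, id] at hq ⊢
    have hs := codes_ends_one q.2
    have hs' := codes_ends_one q'.2
    simp only [codes, Prod.mk.injEq] at hs hs'
    rw [← hs.2, ← hs'.1]
    exact mem_nextStates hq
  · rw [hsplit]
    refine List.mem_map_of_mem ?_
    rw [reversals, List.mem_flatMap]
    refine ⟨a.2, by cases a.2 <;> simp, ?_⟩
    rw [List.map_cons (f := fun γ : SPerm d × Bool => γ.2)]
    refine mem_search (fun _ _ => rfl) (by simp [hl]; simp at hD; omega) ?_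
    have : a.2 :: D'.map (fun γ => γ.2) = (a :: D').map fun γ => γ.2 := rfl
    rw [this, List.zip_map_right, List.zip_map_right, List.isChain_iff_getElem]
    rw [fits_iff, List.zip_map_right, List.isChain_iff_getElem] at h2
    intro i hi
    have hi' := h2 i (by simpa using hi)
    -- The end states of level 1 are the first and last state found, so they are known before any
    -- reversal is chosen.
    have he : codes ((ends a (1, 1)).1, (ends b (1, 1)).2) =
        (((a :: D').map fun γ => (key γ).1).headD [],
          ((a :: D').map fun γ => (key γ).1).getLastD []) := by
      have hs := codes_ends_one a
      have hs' := codes_ends_one b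
      simp only [codes, Prod.mk.injEq] at hs hs'
      rw [codes, Prod.mk.injEq, hs.1, hs'.2]
      refine ⟨rfl, ?_⟩
      rw [List.getLastD_eq_getLast?, List.getLast?_map, hb]
      rfl
    rw [he] at hi'
    simp only [List.getElem_map, List.getElem_zip, Prod.map_fst, Prod.map_snd, id] at hi' ⊢
    rw [nextReversals, List.mem_filter]
    exact ⟨by simp, hi'⟩

/-! ### The two lists and their conjugates -/

/-- The codes of the images that make up the first curve. -/
def firstKeys : ℕ → List (List (ℕ × Bool) × Bool)
  | 3 => [([(1, true), (0, true), (2, false)], false),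
      ([(2, false), (1, true), (0, true)], false),
      ([(2, true), (1, false), (0, true)], true),
      ([(2, true), (0, false), (1, true)], false),
      ([(2, false), (0, false), (1, false)], true),
      ([(2, false), (1, false), (0, false)], false),
      ([(2, true), (1, true), (0, false)], true),
      ([(1, true), (2, true), (0, false)], true)]
  | 4 => [([(2, true), (1, true), (0, true), (3, false)], false),
      ([(3, false), (2, true), (0, true), (1, true)], false),
      ([(3, true), (2, false), (1, true), (0, true)], true),
      ([(3, true), (1, false), (2, true), (0, true)], false),
      ([(3, false), (1, false), (2, false), (0, true)], true),
      ([(3, false), (2, false), (1, false), (0, true)], false),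
      ([(3, true), (2, true), (0, false), (1, true)], true),
      ([(3, true), (1, true), (0, false), (2, true)], false),
      ([(3, false), (1, true), (0, false), (2, false)], true),
      ([(3, false), (2, true), (0, false), (1, false)], false),
      ([(3, true), (2, false), (1, false), (0, false)], true),
      ([(3, true), (1, false), (2, false), (0, false)], false),
      ([(3, false), (1, false), (2, true), (0, false)], true),
      ([(3, false), (2, false), (1, true), (0, false)], false),
      ([(3, true), (2, true), (1, true), (0, false)], true),
      ([(2, true), (1, true), (3, true), (0, false)], true)]
  | _ => []

/-- The codes of the images that make up the second curve. -/
def secondKeys : ℕ → List (List (ℕ × Bool) × Bool)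
  | 3 => [([(2, false), (0, false), (1, false)], true),
      ([(1, false), (2, false), (0, false)], true),
      ([(1, false), (2, false), (0, false)], false),
      ([(1, true), (0, true), (2, false)], true),
      ([(1, true), (0, true), (2, false)], false),
      ([(1, false), (2, true), (0, true)], true),
      ([(1, false), (2, true), (0, true)], false),
      ([(2, true), (1, false), (0, true)], false)]
  | 4 => [([(3, false), (1, false), (0, false), (2, false)], true),
      ([(2, false), (3, false), (0, false), (1, false)], true),
      ([(2, false), (3, false), (1, false), (0, false)], false),
      ([(2, true), (1, true), (3, false), (0, false)], true),
      ([(2, true), (1, true), (3, false), (0, false)], false),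
      ([(2, false), (3, true), (1, true), (0, false)], true),
      ([(2, false), (3, true), (0, true), (1, false)], false),
      ([(2, true), (1, false), (0, true), (3, false)], true),
      ([(2, true), (1, false), (0, true), (3, false)], false),
      ([(2, false), (3, false), (0, true), (1, true)], true),
      ([(2, false), (3, false), (1, true), (0, true)], false),
      ([(2, true), (1, true), (3, true), (0, true)], true),
      ([(2, true), (1, true), (3, true), (0, true)], false),
      ([(2, false), (3, true), (1, false), (0, true)], true),
      ([(2, false), (3, true), (1, false), (0, true)], false),
      ([(3, true), (1, false), (2, false), (0, true)], false)]
  | _ => []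

/-- The codes of the images that make up the reflected and reversed curve. -/
def conjKeys (d : ℕ) (K : List (List (ℕ × Bool) × Bool)) : List (List (ℕ × Bool) × Bool) :=
  (K.map fun p => (mulCode (mulCode (flipCode d) p.1) (flipCode d), p.2)).reverse

theorem map_key_conj (D : List (SPerm d × Bool)) :
    ((D.map fun γ => comp (SPerm.flip d, true) (comp γ (SPerm.flip d, true))).reverse).map key =
      conjKeys d (D.map key) := by
  rw [conjKeys, List.map_reverse, List.map_map, List.map_map, List.reverse_inj]
  refine List.map_congr_left fun γ _ => ?_
  obtain ⟨g, r⟩ := γ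
  cases r <;> simp [key, comp, ← code_flip, ← code_mul, mul_assoc]

instance : CodeFacts 3 where
  grayCurve_eq := by decide +kernel
  mem_allCodes_of_mem := by decide +kernel
  exists_group := by decide +kernel

instance : CodeFacts 4 where
  grayCurve_eq := by decide +kernel
  mem_allCodes_of_mem := by decide +kernel
  exists_group := by decide +kernel

/-! ### End states and end vertices of the curves -/

/-- The codes of the end states and the coordinates of the end vertices of the `k`-th curve. -/
def endData (d : ℕ) (K : List (List (ℕ × Bool) × Bool)) :
    ℕ → (List (ℕ × Bool) × List (ℕ × Bool)) × (List ℕ × List ℕ)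
  | 0 => ((oneCode d, oneCode d), ([], []))
  | k + 1 =>
    let p := endData d K k
    (((endsCode d (K.headD ([], false)) p.1).1, (endsCode d (K.getLastD ([], false)) p.1).2),
      ((List.range d).map fun j => 2 * p.2.1.getD j 0 + entryBit p.1.1 j,
        (List.range d).map fun j => 2 * p.2.2.getD j 0 + exitBit d p.1.2 j))

/-- The vertex with the given coordinates. -/
def ofNats (d : ℕ) (a : List ℕ) : Vertex d := fun j => (a.getD j 0 : ℕ)

theorem shift_one_ofNats (a : List ℕ) {v : Vertex d} {n : ℕ → ℕ} (h : ∀ j : Fin d, v j = n j) :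
    shift 1 (ofNats d a) v = ofNats d ((List.range d).map fun j => 2 * a.getD j 0 + n j) := by
  funext j
  simp [shift, ofNats, h]

theorem endData_succ {D : List (SPerm d × Bool)} {a b : SPerm d × Bool} (ha : D.head? = some a)
    (hb : D.getLast? = some b) {k : ℕ} {e : SPerm d × SPerm d}
    (he : codes e = (endData d (D.map key) k).1) :
    codes ((ends a e).1, (ends b e).2) = (endData d (D.map key) (k + 1)).1 := by
  have h1 := codes_ends a e
  have h2 := codes_ends b e
  rw [he] at h1 h2
  have h3 : (D.map key).headD ([], false) = key a := by
    rw [List.headD_eq_head?_getD, List.head?_map, ha]; rfl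
  have h4 : (D.map key).getLastD ([], false) = key b := by
    rw [List.getLastD_eq_getLast?, List.getLast?_map, hb]; rfl
  simp only [endData, h3, h4, ← h1, ← h2, codes]

theorem codes_ends_pattern [GrayFacts d] {D : List (SPerm d × Bool)} (hD : D.length = 2 ^ d) :
    ∀ k, ∃ e, HasEnds (pattern D k) e ∧ codes e = (endData d (D.map key) k).1
  | 0 => ⟨(1, 1), by simp [HasEnds, pattern], by simp [codes, code_one, endData]⟩
  | k + 1 => by
    obtain ⟨e, he, hc⟩ := codes_ends_pattern hD k
    obtain ⟨p, q, -, -, ha, hb⟩ := zip_head?_getLast? hD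
    exact ⟨_, hasEnds_pattern_succ hD he ha hb, endData_succ ha hb hc⟩

theorem curves_head?_getLast? [GrayFacts d] {D : List (SPerm d × Bool)}
    (hD : D.length = 2 ^ d) : ∀ k,
      (curves D k).head? = some (ofNats d (endData d (D.map key) k).2.1) ∧
      (curves D k).getLast? = some (ofNats d (endData d (D.map key) k).2.2)
  | 0 => by
    -- Missing entries count as 0, so the empty lists in `endData` stand for the origin.
    have : ofNats d [] = 0 := by funext j; simp [ofNats]
    simp [curves_zero, endData, this]
  | k + 1 => by
    obtain ⟨e, ⟨h1, h2⟩, hc⟩ := codes_ends_pattern hD k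
    obtain ⟨h3, h4⟩ := curves_head?_getLast? hD k
    rw [curves, List.head?_map] at h3
    rw [curves, List.getLast?_map] at h4
    obtain ⟨x, hx, hx'⟩ := Option.map_eq_some_iff.1 h1
    obtain ⟨y, hy, hy'⟩ := Option.map_eq_some_iff.1 h2
    rw [hx, Option.map_some, Option.some_inj] at h3
    rw [hy, Option.map_some, Option.some_inj] at h4
    rw [curves_succ hD, inflate_head? hx, inflate_getLast? hy, h3, h4, hx', hy']
    have hc1 : code e.1 = (endData d (D.map key) k).1.1 := congrArg Prod.fst hc
    have hc2 : code e.2 = (endData d (D.map key) k).1.2 := congrArg Prod.snd hc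
    rw [shift_one_ofNats _ (entry_eq_entryBit e.1), shift_one_ofNats _ (exit_eq_exitBit e.2),
      hc1, hc2]
    exact ⟨rfl, rfl⟩

/-- A finite test for admissibility. -/
structure IsValid (d : ℕ) (K : List (List (ℕ × Bool) × Bool)) : Prop where
  length_eq : K.length = 2 ^ d
  mem_allCodes : ∀ p ∈ K, p.1 ∈ allCodes d d
  periodic : (endData d K 3).1 = (endData d K 1).1
  fits : ∀ k < 3, ((grayBits d).zip K).IsChain
    fun q q' => fitsTest d (endData d K k).1 q q' = true

/-- Level 3 has the end states of level 1, so those of levels 0, 1 and 2 are closed under the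
recursion. -/
theorem IsValid.isAdmissible [GrayFacts d] [CodeFacts d] {D : List (SPerm d × Bool)}
    (h : IsValid d (D.map key)) :
    IsAdmissible D {e | ∃ k < 3, codes e = (endData d (D.map key) k).1} where
  length_eq := by simpa using h.length_eq
  one_mem := ⟨0, by norm_num, by simp [codes, code_one, endData]⟩
  fits := by
    rintro e ⟨k, hk, he⟩
    rw [fits_iff, he]
    exact h.fits k hk
  next_mem := by
    rintro e ⟨k, hk, he⟩ a ha b hb
    have := endData_succ ha hb he
    by_cases h3 : k + 1 < 3
    · exact ⟨k + 1, h3, this⟩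
    · obtain rfl : k = 2 := by omega
      exact ⟨1, by norm_num, this.trans h.periodic⟩

/-! ### Comparison of end point distances -/

theorem abs_sub_le_of_mem_cell {k : ℕ} {v w : Vertex d} {x y : EuclideanSpace ℝ (Fin d)}
    (hx : x ∈ cell k v) (hy : y ∈ cell k w) (j : Fin d) :
    |(x j - y j) * 2 ^ k - (v j - w j)| ≤ 1 := by
  have hk : (0 : ℝ) < 2 ^ k := by positivity
  have h1 := hx j
  have h2 := hy j
  rw [div_le_iff₀ hk, le_div_iff₀ hk] at h1 h2
  rw [abs_le]
  constructor <;> linarith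

/-- Cells fix coordinate differences up to one cell width. The smaller distance is bounded above
using all coordinates, the larger one below by coordinate `i` alone; `hi` keeps the bound
nonnegative before squaring. -/
theorem dist_lt_dist_of_mem_cell {k : ℕ} {v w v' w' : Vertex d}
    {x y x' y' : EuclideanSpace ℝ (Fin d)} (hx : x ∈ cell k v) (hy : y ∈ cell k w)
    (hx' : x' ∈ cell k v') (hy' : y' ∈ cell k w') (i : Fin d) (hi : 1 ≤ |v' i - w' i|)
    (h : ∑ j, (|v j - w j| + 1) ^ 2 < (|v' i - w' i| - 1) ^ 2) : dist x y < dist x' y' := by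
  rw [EuclideanSpace.dist_eq, EuclideanSpace.dist_eq]
  refine Real.sqrt_lt_sqrt (Finset.sum_nonneg fun _ _ => sq_nonneg _) ?_
  refine lt_of_lt_of_le ?_ (Finset.single_le_sum (f := fun j => dist (x' j) (y' j) ^ 2)
    (fun _ _ => sq_nonneg _) (Finset.mem_univ i))
  have hk : (0 : ℝ) < (2 ^ k) ^ 2 := by positivity
  have hk' : (0 : ℝ) < 2 ^ k := by positivity
  refine lt_of_mul_lt_mul_right ?_ hk.le
  rw [Finset.sum_mul]
  have h1 : ∑ j, dist (x j) (y j) ^ 2 * (2 ^ k) ^ 2 ≤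
      ((∑ j, (|v j - w j| + 1) ^ 2 : ℤ) : ℝ) := by
    push_cast
    refine Finset.sum_le_sum fun j _ => ?_
    rw [← mul_pow]
    refine pow_le_pow_left₀ (by positivity) ?_ 2
    have h2 := abs_sub_le_of_mem_cell hx hy j
    have h3 := abs_sub_abs_le_abs_sub ((x j - y j) * 2 ^ k) (v j - w j)
    rw [abs_mul, abs_of_pos hk'] at h3
    rw [Real.dist_eq]
    linarith
  have h2 : (((|v' i - w' i| - 1) ^ 2 : ℤ) : ℝ) ≤ dist (x' i) (y' i) ^ 2 * (2 ^ k) ^ 2 := by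
    have hi' : (1 : ℝ) ≤ |(v' i : ℝ) - w' i| := by exact_mod_cast hi
    push_cast
    rw [← mul_pow]
    refine pow_le_pow_left₀ (by linarith) ?_ 2
    have h2 := abs_sub_le_of_mem_cell hx' hy' i
    have h3 := abs_sub_abs_le_abs_sub ((v' i : ℝ) - w' i) ((x' i - y' i) * 2 ^ k)
    rw [abs_sub_comm _ ((x' i - y' i) * 2 ^ k), abs_mul, abs_of_pos hk'] at h3
    rw [Real.dist_eq]
    linarith
  have h3 : ((∑ j, (|v j - w j| + 1) ^ 2 : ℤ) : ℝ) < (((|v' i - w' i| - 1) ^ 2 : ℤ) : ℝ) :=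
    Int.cast_lt.2 h
  exact (h1.trans_lt h3).trans_le h2

theorem Approximates.mem_cell_zero {A : ℕ → List (Vertex d)}
    {f : unitInterval → EuclideanSpace ℝ (Fin d)} (h : Approximates A f) {k : ℕ} {v : Vertex d}
    (hv : (A k).head? = some v) : f 0 ∈ cell k v := by
  have hl : 0 < (A k).length := by rw [h.isApproximation.length_eq]; positivity
  rw [List.head?_eq_getElem?, List.getElem?_eq_getElem hl, Option.some_inj] at hv
  rw [← hv]
  refine h.mem_cell hl (by simp) ?_
  rw [Set.Icc.coe_zero]
  positivity

theorem Approximates.mem_cell_one {A : ℕ → List (Vertex d)}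
    {f : unitInterval → EuclideanSpace ℝ (Fin d)} (h : Approximates A f) {k : ℕ} {v : Vertex d}
    (hv : (A k).getLast? = some v) : f 1 ∈ cell k v := by
  have hp : 0 < 2 ^ (d * k) := by positivity
  have hl : 2 ^ (d * k) - 1 < (A k).length := by rw [h.isApproximation.length_eq]; omega
  rw [List.getLast?_eq_getElem?, h.isApproximation.length_eq, List.getElem?_eq_getElem hl,
    Option.some_inj] at hv
  rw [← hv]
  have hp' : (0 : ℝ) < 2 ^ (d * k) := by positivity
  have hc : ((2 ^ (d * k) - 1 : ℕ) : ℝ) = 2 ^ (d * k) - 1 := by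
    rw [Nat.cast_sub (by omega)]
    push_cast
    ring
  refine h.mem_cell hl ?_ ?_
  · rw [hc, Set.Icc.coe_one, div_le_one hp']
    linarith
  · rw [hc, Set.Icc.coe_one, sub_add_cancel, div_self hp'.ne']

theorem SameUpToIsometry.dist_eq {f g : unitInterval → EuclideanSpace ℝ (Fin d)}
    (h : SameUpToIsometry f g) : dist (f 0) (f 1) = dist (g 0) (g 1) := by
  obtain ⟨φ, h | h⟩ := h
  · rw [h, h, φ.isometry.dist_eq]
  · rw [h, h, φ.isometry.dist_eq, unitInterval.symm_zero, unitInterval.symm_one, dist_comm]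

/-! ### The classification -/

/-- The finite computations that determine the curves of one dimension. -/
class CurveFacts (d : ℕ) : Prop where
  pos : 0 < d
  isValid_firstKeys : IsValid d (firstKeys d)
  isValid_secondKeys : IsValid d (secondKeys d)
  mem_solutions : ∀ K ∈ solutions d, K = firstKeys d ∨ K = secondKeys d ∨
    K = conjKeys d (firstKeys d) ∨ K = conjKeys d (secondKeys d)
  dist_lt : ∃ i : Fin d,
    1 ≤ |ofNats d (endData d (secondKeys d) 4).2.1 i -
      ofNats d (endData d (secondKeys d) 4).2.2 i| ∧
    ∑ j, (|ofNats d (endData d (firstKeys d) 4).2.1 j -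
      ofNats d (endData d (firstKeys d) 4).2.2 j| + 1) ^ 2 <
    (|ofNats d (endData d (secondKeys d) 4).2.1 i -
      ofNats d (endData d (secondKeys d) 4).2.2 i| - 1) ^ 2

theorem exists_eq_placeV_of_key_eq [GrayFacts d] {D E : List (SPerm d × Bool)}
    (hE : E.length = 2 ^ d) (h : D.map key = E.map key ∨ D.map key = conjKeys d (E.map key)) :
    ∃ δ, ∀ k, curves D k = placeV k 0 δ (curves E k) := by
  have hinj : Function.Injective (List.map (key (d := d))) :=
    List.map_injective_iff.2 key_injective
  rcases h with h | h
  · refine ⟨(1, false), fun k => ?_⟩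
    rw [hinj h]
    simp [placeV]
  · refine ⟨(SPerm.flip d, true), fun k => ?_⟩
    rw [← map_key_conj] at h
    rw [hinj h, curves, pattern_conj E hE k, map_fst_place, curves]

/-- There are exactly two curves of the required kind, provided that the finite computations
have the right outcome. -/
theorem exists_two_curves (d : ℕ) [GrayFacts d] [StepFacts d] [CodeFacts d] [CurveFacts d] :
    ∃ f g : unitInterval → EuclideanSpace ℝ (Fin d),
      IsSelfSimilarHyperorthogonalWellFolded f ∧ IsSelfSimilarHyperorthogonalWellFolded g ∧
      ¬ SameUpToIsometry f g ∧
      ∀ h : unitInterval → EuclideanSpace ℝ (Fin d),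
        IsSelfSimilarHyperorthogonalWellFolded h →
          SameUpToIsometry h f ∨ SameUpToIsometry h g := by
  have hv := CurveFacts.isValid_firstKeys (d := d)
  have hv' := CurveFacts.isValid_secondKeys (d := d)
  obtain ⟨E, hE⟩ := exists_map_key hv.mem_allCodes
  obtain ⟨E', hE'⟩ := exists_map_key hv'.mem_allCodes
  rw [← hE] at hv
  rw [← hE'] at hv'
  have ha := hv.isAdmissible
  have ha' := hv'.isAdmissible
  obtain ⟨f, hf, hfA⟩ := (isApproximation_curves ha).exists_approximates
  obtain ⟨g, hg, hgA⟩ := (isApproximation_curves ha').exists_approximates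
  refine ⟨f, g, ⟨hf, _, hfA, wellFolded_curves ha, hyperorthogonal_curves ha,
    selfSimilar_curves ha.length_eq⟩, ⟨hg, _, hgA, wellFolded_curves ha',
    hyperorthogonal_curves ha', selfSimilar_curves ha'.length_eq⟩, fun hfg => ?_, ?_⟩
  -- Isometries and reversal preserve the distance of the end points, which is smaller for `f` than
  -- for `g`.
  · obtain ⟨i, hi, hlt⟩ := CurveFacts.dist_lt (d := d)
    rw [← hE, ← hE'] at hlt
    rw [← hE'] at hi
    have h1 := curves_head?_getLast? ha.length_eq 4
    have h2 := curves_head?_getLast? ha'.length_eq 4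
    exact (dist_lt_dist_of_mem_cell (hfA.mem_cell_zero h1.1) (hfA.mem_cell_one h1.2)
      (hgA.mem_cell_zero h2.1) (hgA.mem_cell_one h2.2) i hi hlt).ne hfg.dist_eq
  · rintro h ⟨-, A, hA, hw, hh, hs⟩
    obtain ⟨s, D, hD, hc, hAD⟩ :=
      exists_eq_placeV_curves CurveFacts.pos hA.isApproximation hw hh hs
    obtain ⟨p, q, -, -, hp, hq⟩ := zip_head?_getLast? hD
    have h0 : HasEnds (pattern D 0) (1, 1) := by simp [HasEnds, pattern]
    -- The fit conditions for the end states of levels 0 and 1 already place the list among the four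
    -- solutions.
    have h1 := hasEnds_pattern_succ hD h0 hp hq
    have hmem := mem_solutions hD hp hq (fits_of_isChain_pattern hD hc h0)
      (fits_of_isChain_pattern hD hc h1)
    have same : ∀ {E : List (SPerm d × Bool)} {f : unitInterval → EuclideanSpace ℝ (Fin d)},
        E.length = 2 ^ d → Approximates (curves E) f →
        (D.map key = E.map key ∨ D.map key = conjKeys d (E.map key)) →
        SameUpToIsometry h f := fun {E f} hl hf hk => by
      obtain ⟨δ, hδ⟩ := exists_eq_placeV_of_key_eq hl hk
      refine (hf.sameUpToIsometry hA (comp (s, false) δ) fun k => ?_).symm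
      have := placeV_placeV 0 k 0 (s, false) δ (curves E k)
      rw [hAD, hδ]
      simpa using this
    rcases CurveFacts.mem_solutions _ hmem with h | h | h | h
    · exact Or.inl (same ha.length_eq hfA (Or.inl (h.trans hE.symm)))
    · exact Or.inr (same ha'.length_eq hgA (Or.inl (h.trans hE'.symm)))
    · exact Or.inl (same ha.length_eq hfA (Or.inr (by rw [h, hE])))
    · exact Or.inr (same ha'.length_eq hgA (Or.inr (by rw [h, hE'])))

instance : CurveFacts 3 where
  pos := by norm_num
  isValid_firstKeys := ⟨by decide +kernel, by decide +kernel, by decide +kernel, by decide +kernel⟩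
  isValid_secondKeys := ⟨by decide +kernel, by decide +kernel, by decide +kernel, by decide +kernel⟩
  mem_solutions := by decide +kernel
  dist_lt := by decide +kernel

instance : CurveFacts 4 where
  pos := by norm_num
  isValid_firstKeys := ⟨by decide +kernel, by decide +kernel, by decide +kernel, by decide +kernel⟩
  isValid_secondKeys := ⟨by decide +kernel, by decide +kernel, by decide +kernel, by decide +kernel⟩
  mem_solutions := by decide +kernel
  dist_lt := by decide +kernel

end GridCurve

theorem mainTheorem6 (d : ℕ) (hd : d = 3 ∨ d = 4) :
    ∃ f g : unitInterval → EuclideanSpace ℝ (Fin d),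
      GridCurve.IsSelfSimilarHyperorthogonalWellFolded f ∧
      GridCurve.IsSelfSimilarHyperorthogonalWellFolded g ∧
      ¬ GridCurve.SameUpToIsometry f g ∧
      ∀ h : unitInterval → EuclideanSpace ℝ (Fin d),
        GridCurve.IsSelfSimilarHyperorthogonalWellFolded h →
          GridCurve.SameUpToIsometry h f ∨ GridCurve.SameUpToIsometry h g := by
  rcases hd with rfl | rfl
  · exact GridCurve.exists_two_curves 3
  · exact GridCurve.exists_two_curves 4
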